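/- Let $\lambda_1,\lambda_2,\lambda_3\in\mathbb C\setminus\{0,1\}$ be pairwise distinct, put $f(x,y)=xy(x-y)(x-\lambda_1y)(x-\lambda_2y)(x-\lambda_3y)$ and $f(x)=f(x,1)$, and let $C$ be the genus two curve $z^2=f(x,y)$ in the weighted projective plane $\mathbb P(1,1,3)$ with coordinates $[x:y:z]$, so that $z^2=f(x)$ is the equation of $C$ in the chart $y=1$. Let $\mathcal L=\mathcal O_{\mathbb P(1,1,3)}(3)|_C$. Its complete linear system $|\mathcal L|\cong\mathbb P^4$ has coordinates $(\alpha_0:\cdots:\alpha_4)$, this point corresponding to the cubic $D$ with equation $$\alpha_0x^3+\alpha_1x^2y+\alpha_2xy^2+\alpha_3y^3+\alpha_4z=0 .$$ Let $\varphi\colon \mathrm{Sym}^3(\mathrm{Sym}^2C)\to \mathrm{Sym}^6C$ be the sum map, embed $|\mathcal L|$ in $\mathrm{Sym}^6C$ by $D\mapsto D\cap C$ (points counted with intersection multiplicity), let $\mathscr G_C=\varphi^{-1}(|\mathcal L|)$, and let $\psi\colon\mathscr G_C\to|\mathcal L|\cong\mathbb P^4$ be the degree $15$ covering obtained by restricting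 $\varphi$. Let $B\subset\mathbb P^4$ be the branch locus of $\psi$, that is, the set of points whose fibre does not consist of $15$ distinct points. Then $B$ is the set of cubics $D$ for which the scheme $D\cap C$ is nonreduced. Moreover the discriminant with respect to $x$ of the polynomial $\alpha_4^2f(x)-(\alpha_0x^3+\alpha_1x^2+\alpha_2x+\alpha_3)^2$, of degree $6$ in $x$ over $\mathbb C[\alpha_0,\dots,\alpha_4]$, is divisible by $\alpha_4^6$, and $$F=\frac1{\alpha_4^{6}}\,\mathrm{Disc}_x\left(\alpha_4^2f(x)-\left(\alpha_0x^3+\alpha_1x^2+\alpha_2x+\alpha_3\right)^2\right)\in\mathbb C[\alpha_0,\dots,\alpha_4]$$ is an equation of $B$: it is homogeneous of degree $14$, $B$ is the set of zeros of $F$ in $\mathbb P^4$, and $F$ generates the homogeneous ideal of all polynomials vanishing on $B$. -/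

import Mathlib

set_option maxSynthPendingDepth 3

open scoped Polynomial LinearAlgebra.Projectivization

noncomputable section

namespace GenusTwoCubics

/-- The binary sextic `f(x, y) = x y (x - y) (x - l₀ y) (x - l₁ y) (x - l₂ y)`, as a polynomial in
the coordinates `x = X 0`, `y = X 1`, `z = X 2` of the weighted projective plane `ℙ(1, 1, 3)`. -/
def sexticForm (l : Fin 3 → ℂ) : MvPolynomial (Fin 3) ℂ :=
  MvPolynomial.X 0 * MvPolynomial.X 1 * (MvPolynomial.X 0 - MvPolynomial.X 1) *
    ∏ i : Fin 3, (MvPolynomial.X 0 - MvPolynomial.C (l i) * MvPolynomial.X 1)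

/-- The form `z² - f(x, y)` of weighted degree 6 that defines the genus two curve. -/
def curveForm (l : Fin 3 → ℂ) : MvPolynomial (Fin 3) ℂ :=
  MvPolynomial.X 2 ^ 2 - sexticForm l

/-- The cubic form `a₀ x³ + a₁ x² y + a₂ x y² + a₃ y³ + a₄ z` of weighted degree 3. -/
def cubicForm (a : Fin 5 → ℂ) : MvPolynomial (Fin 3) ℂ :=
  MvPolynomial.C (a 0) * MvPolynomial.X 0 ^ 3
    + MvPolynomial.C (a 1) * (MvPolynomial.X 0 ^ 2 * MvPolynomial.X 1)
    + MvPolynomial.C (a 2) * (MvPolynomial.X 0 * MvPolynomial.X 1 ^ 2)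
    + MvPolynomial.C (a 3) * MvPolynomial.X 1 ^ 3
    + MvPolynomial.C (a 4) * MvPolynomial.X 2

/-- The nonzero solutions `(x, y, z)` of `z² = f(x, y)`. -/
def CurveCone (l : Fin 3 → ℂ) : Type :=
  {v : Fin 3 → ℂ // v ≠ 0 ∧ MvPolynomial.eval v (curveForm l) = 0}

/-- Two triples are equivalent if they define the same point `[x : y : z]` of `ℙ(1, 1, 3)`,
that is, if they differ by `t • (x, y, z) = (t x, t y, t³ z)` for some `t ≠ 0`. -/
def weightedSetoid (l : Fin 3 → ℂ) : Setoid (CurveCone l) where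
  r v w := ∃ t : ℂ, t ≠ 0 ∧
    w.1 0 = t * v.1 0 ∧ w.1 1 = t * v.1 1 ∧ w.1 2 = t ^ 3 * v.1 2
  iseqv :=
    { refl := fun v => ⟨1, one_ne_zero, by simp, by simp, by simp⟩
      symm := by
        rintro v w ⟨t, ht, h0, h1, h2⟩
        refine ⟨t⁻¹, inv_ne_zero ht, ?_, ?_, ?_⟩
        · rw [h0]; field_simp
        · rw [h1]; field_simp
        · rw [h2]; field_simp
      trans := by
        rintro u v w ⟨t, ht, h0, h1, h2⟩ ⟨s, hs, k0, k1, k2⟩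
        refine ⟨s * t, mul_ne_zero hs ht, ?_, ?_, ?_⟩
        · rw [k0, h0]; ring
        · rw [k1, h1]; ring
        · rw [k2, h2]; ring }

/-- The closed points of the curve `C : z² = f(x, y)` in `ℙ(1, 1, 3)`. -/
def Curve (l : Fin 3 → ℂ) : Type := Quotient (weightedSetoid l)

/-- Homogeneous coordinates `(x, y, z)` of a point of `C`. -/
def Curve.rep {l : Fin 3 → ℂ} (p : Curve l) : Fin 3 → ℂ :=
  (Quotient.out (s := weightedSetoid l) p).1

/-- Dehomogenisation in the standard affine chart of `ℙ(1, 1, 3)` used at `[x : y : z]`: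
`y = 1` if the point lies in it, and `x = 1` otherwise (a point of `C` with `y = 0` has `x ≠ 0`).
The two affine coordinates of the chart are `(x, z)`, resp. `(y, z)`; they are the inner and the
outer variable of `ℂ[X][X]`. -/
def dehomogenize (v : Fin 3 → ℂ) : MvPolynomial (Fin 3) ℂ →ₐ[ℂ] ℂ[X][X] :=
  open Classical in
  if v 1 ≠ 0 then MvPolynomial.aeval ![Polynomial.C Polynomial.X, 1, Polynomial.X]
  else MvPolynomial.aeval ![1, Polynomial.C Polynomial.X, Polynomial.X]

/-- The affine coordinates of the point `[x : y : z]` in the chart of `dehomogenize`. -/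
def chartCoord (v : Fin 3 → ℂ) : ℂ × ℂ :=
  open Classical in
  if v 1 ≠ 0 then (v 0 / v 1, v 2 / v 1 ^ 3) else (v 1 / v 0, v 2 / v 0 ^ 3)

instance ker_evalEval_isPrime (c : ℂ × ℂ) :
    (RingHom.ker (Polynomial.evalEvalRingHom c.1 c.2)).IsPrime :=
  RingHom.ker_isPrime _

/-- The local ring of the affine plane with coordinate ring `ℂ[X][X]` at the point `c`. -/
abbrev PlaneLocalRing (c : ℂ × ℂ) : Type :=
  Localization.AtPrime (RingHom.ker (Polynomial.evalEvalRingHom c.1 c.2))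

/-- The ideal that the curve `C` and the cubic with coefficients `a` generate in the local ring
of the plane at (the affine coordinates of) the triple `v`. -/
def intersectionIdeal (l : Fin 3 → ℂ) (a : Fin 5 → ℂ) (v : Fin 3 → ℂ) :
    Ideal (PlaneLocalRing (chartCoord v)) :=
  Ideal.span
    {algebraMap ℂ[X][X] (PlaneLocalRing (chartCoord v)) (dehomogenize v (curveForm l)),
      algebraMap ℂ[X][X] (PlaneLocalRing (chartCoord v)) (dehomogenize v (cubicForm a))}

/-- The local ring `𝒪_{p, D ∩ C}` at `p ∈ C` of the intersection of `C` with the cubic `D` with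
coefficients `a`, i.e. of the zero scheme of the section of `ℒ = 𝒪_C(3)` given by `a`.
It is zero if `p ∉ D`. -/
abbrev IntersectionLocalRing (l : Fin 3 → ℂ) (a : Fin 5 → ℂ) (p : Curve l) : Type :=
  PlaneLocalRing (chartCoord p.rep) ⧸ intersectionIdeal l a p.rep

/-- The multiplicity of `D ∩ C` at `p`: the length of the local ring `𝒪_{p, D ∩ C}`. -/
def intersectionMultiplicity (l : Fin 3 → ℂ) (a : Fin 5 → ℂ) (p : Curve l) : ℕ∞ :=
  Module.length (IntersectionLocalRing l a p) (IntersectionLocalRing l a p)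

/-- The linear system `|ℒ| = ℙ H⁰(C, ℒ) ≅ ℙ⁴` of cubics, with coordinates `(a₀ : ⋯ : a₄)`. -/
abbrev LinearSystem : Type := ℙ ℂ (Fin 5 → ℂ)

/-- The sum map `φ : Sym³ (Sym² C) → Sym⁶ C`,
`[p₁ + p₂] + [p₃ + p₄] + [p₅ + p₆] ↦ p₁ + ⋯ + p₆`; elements of `Sym⁶ C` are written as
multisets. -/
def sumMap {X : Type} (ξ : Sym (Sym X 2) 3) : Multiset X :=
  ((ξ : Multiset (Sym X 2)).map (fun η => (η : Multiset X))).sum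

/-- The multiset `ξ` of points of `C` is the divisor `D ∩ C`, points counted with multiplicity. -/
def IsIntersectionDivisor (l : Fin 3 → ℂ) (D : LinearSystem) (ξ : Multiset (Curve l)) : Prop :=
  open Classical in
  ∀ p : Curve l, (ξ.count p : ℕ∞) = intersectionMultiplicity l D.rep p

/-- The closed points of the fourfold `𝒢_C`, the fibre of `φ` over `|ℒ| ↪ Sym⁶ C`,
`D ↦ D ∩ C`, i.e. the fibre product of `Sym³ (Sym² C)` and `|ℒ|` over `Sym⁶ C`. -/
def CoveringSpace (l : Fin 3 → ℂ) : Type :=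
  {q : Sym (Sym (Curve l) 2) 3 × LinearSystem // IsIntersectionDivisor l q.2 (sumMap q.1)}

/-- The degree 15 covering `ψ : 𝒢_C → |ℒ|`, the restriction of `φ`. -/
def covering (l : Fin 3 → ℂ) (q : CoveringSpace l) : LinearSystem := q.1.2

/-- The branch locus of (the map on closed points of) a covering of degree `d`: the points whose
fibre does not consist of `d` distinct points. For a finite surjective morphism from a normal
variety to a nonsingular one over `ℂ` these are the points over which it is not unramified. -/
def branchLocus {X Y : Type} (d : ℕ) (φ : X → Y) : Set Y :=
  {y | Nat.card (φ ⁻¹' {y}) ≠ d}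

/-- The branch locus `B ⊆ ℙ⁴` of `ψ`. -/
def cubicBranchLocus (l : Fin 3 → ℂ) : Set LinearSystem :=
  branchLocus 15 (covering l)

/-- The vectors in `ℂ⁵ ∖ 0` that represent a point of `B`. -/
def affineCone (B : Set LinearSystem) : Set (Fin 5 → ℂ) :=
  {a | ∃ h : a ≠ 0, Projectivization.mk ℂ a h ∈ B}

/-- `f(x) = f(x, 1)`, so that `z² = f(x)` is the equation of `C` in the chart `y = 1`. -/
def affineSextic (l : Fin 3 → ℂ) : ℂ[X] :=
  MvPolynomial.aeval ![Polynomial.X, 1, 0] (sexticForm l)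

/-- The polynomial `α₄² f(x) - (α₀ x³ + α₁ x² + α₂ x + α₃)²` in `x`, with coefficients in
`ℂ[α₀, …, α₄]`. It has degree 6 in `x`. -/
def resultantPoly (l : Fin 3 → ℂ) : (MvPolynomial (Fin 5) ℂ)[X] :=
  Polynomial.C (MvPolynomial.X 4) ^ 2 * (affineSextic l).map MvPolynomial.C
    - (Polynomial.C (MvPolynomial.X 0) * Polynomial.X ^ 3
      + Polynomial.C (MvPolynomial.X 1) * Polynomial.X ^ 2
      + Polynomial.C (MvPolynomial.X 2) * Polynomial.X
      + Polynomial.C (MvPolynomial.X 3)) ^ 2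

end GenusTwoCubics

end

/-!
Write `G = α₄² f - c²` with `c = α₀ x³ + α₁ x² + α₂ x + α₃`; the roots of `G` are the abscissae of
the points of `D ∩ C`.

*Divisibility.* With `J = c f' - 2 c' f` one has `c G' = α₄² J + 2 c' G`. Taking resultants with
`G` gives `Disc(G) · W = - α₄⁶ Res(G, J)`, where `W = Res(f, c)` is, up to sign, the product of the
six linear forms that vanish on the cubics through a given Weierstrass point of `C`
(`discr_mul_weierstrassProduct`). As `W` does not involve `α₄`, the discriminant is divisible by
`α₄⁶`. The quotient `F` satisfies `F W = - Res(G, J)`, and as `G = - c²` for `α₄ = 0`, this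
determines it on that hyperplane: `F = 64 Disc(c)² W` there (`restrict_eq`). The degree of `F` is
read off the Sylvester matrix.

*Zeros of `F`.* For `α₄ ≠ 0`, `F` vanishes exactly if `G` has a double root in the affine line; a
root at infinity is harmless, since it is simple when `α₀ = 0`, so the discriminant is compared
with the resultant of `G` and its polar at a general point, which specialises well to a vanishing
leading coefficient (`eval_eq_zero_iff_of_ne_zero`). For `α₄ = 0`, the formula for the restriction
shows that `F` vanishes exactly if `c`, as a binary cubic, has a double root or vanishes at a
branch point of `C → ℙ¹`. In both cases this means that `D` is tangent to `C` somewhere. At a point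
where `D` is transverse to `C` the local intersection ring is `ℂ`
(`localIdeal_eq_maximalIdeal`), and at a point of tangency it is not reduced, since it maps to the
dual numbers along the tangent vector (`not_isReduced_of_tangent`). So `F` vanishes at `D` if and
only if `D ∩ C` is nonreduced.

*The branch locus.* The fibre of `ψ` over `D` is the set of decompositions of the divisor `D ∩ C`
into three pairs. A divisor of six distinct points has fifteen decompositions
(`ncard_sumMap_eq_of_nodup`), and one with a repeated point has fewer
(`ncard_sumMap_eq_ne_of_not_nodup`). A nonreduced local ring has length at least two, so the
repeated points appear exactly if `D ∩ C` is nonreduced.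

*The ideal.* The cubics tangent to `C` at a point of its affine part form an irreducible family: a
vector bundle over an affine integral curve, whose coordinate ring is the polynomial ring
`TangencyRing`. The kernel of the restriction of polynomials to this family is prime, so it
contains a prime factor `H` of `F`. Every zero of `F` with `α₄ ≠ 0` lies in the image of the
family, so by the Nullstellensatz `F` divides a power of `α₄ H`. As `α₄ ∤ F`, it follows that `F`
is a power of `H` up to a unit; and as `F|_{α₄ = 0} = 64 Disc(c)² W` vanishes to order one along
`α₃ = 0`, the exponent is one. Hence `F` is prime (`prime_of_mul_eq_discr`), and the Nullstellensatz
identifies its ideal with the ideal of the cone over its zero locus.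
-/

noncomputable section

namespace GenusTwoCubics

/-! ### Resultants with prescribed formal degrees -/

section Resultants

open Polynomial

variable {R : Type*} [CommRing R]

theorem resultant_mul_right_of_le (p q₁ q₂ : R[X]) {m n₁ n₂ : ℕ} (hp : p.natDegree ≤ m)
    (h₁ : q₁.natDegree ≤ n₁) (h₂ : q₂.natDegree ≤ n₂) :
    resultant p (q₁ * q₂) m (n₁ + n₂) = resultant p q₁ m n₁ * resultant p q₂ m n₂ := by
  obtain ⟨k₁, rfl⟩ := Nat.exists_eq_add_of_le h₁
  obtain ⟨k₂, rfl⟩ := Nat.exists_eq_add_of_le h₂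
  rw [show q₁.natDegree + k₁ + (q₂.natDegree + k₂) = (q₁.natDegree + q₂.natDegree) + (k₁ + k₂) by
    ring, resultant_add_right_deg _ _ _ _ _ natDegree_mul_le, resultant_mul_right _ _ _ _ hp,
    resultant_add_right_deg _ _ _ _ _ le_rfl, resultant_add_right_deg _ _ _ _ _ le_rfl]
  ring

theorem resultant_mul_left_of_le (p₁ p₂ q : R[X]) {m₁ m₂ n : ℕ} (hq : q.natDegree ≤ n)
    (h₁ : p₁.natDegree ≤ m₁) (h₂ : p₂.natDegree ≤ m₂) :
    resultant (p₁ * p₂) q (m₁ + m₂) n = resultant p₁ q m₁ n * resultant p₂ q m₂ n := by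
  rw [resultant_comm, resultant_mul_right_of_le _ _ _ hq h₁ h₂, resultant_comm p₁,
    resultant_comm p₂, add_mul, pow_add]
  ring

theorem resultant_neg_right (p q : R[X]) (m n : ℕ) :
    resultant p (-q) m n = (-1) ^ m * resultant p q m n := by
  have := resultant_C_mul_right p q m n (-1)
  rwa [map_neg, map_one, neg_one_mul] at this

theorem resultant_neg_left (p q : R[X]) (m n : ℕ) :
    resultant (-p) q m n = (-1) ^ n * resultant p q m n := by
  have := resultant_C_mul_left p q m n (-1)
  rwa [map_neg, map_one, neg_one_mul] at this

theorem resultant_eq_zero_of_common_root {p q : R[X]} {m n : ℕ} (hp : p.natDegree ≤ m)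
    (hq : q.natDegree ≤ n) (hmn : m ≠ 0 ∨ n ≠ 0) {x : R} (hpx : p.eval x = 0)
    (hqx : q.eval x = 0) : resultant p q m n = 0 := by
  obtain ⟨u, v, -, -, h⟩ := exists_mul_add_mul_eq_C_resultant p q hp hq hmn
  simpa [hpx, hqx] using (congrArg (eval x) h).symm

/-- Over an algebraically closed field, two polynomials of formal degrees `m` and `n` with
vanishing resultant have a common root, unless they have the common root `∞`. -/
theorem exists_common_root_of_resultant_eq_zero {K : Type*} [Field K] [IsAlgClosed K]
    {p q : K[X]} {m n : ℕ} (hp : p.natDegree ≤ m) (hq : q.natDegree ≤ n)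
    (h : p.coeff m ≠ 0 ∨ q.coeff n ≠ 0) (hr : resultant p q m n = 0) :
    ∃ x, p.eval x = 0 ∧ q.eval x = 0 := by
  have key : resultant p q = 0 := by
    rcases h with h | h
    · obtain rfl : p.natDegree = m := le_antisymm hp (le_natDegree_of_ne_zero h)
      obtain ⟨k, rfl⟩ := Nat.exists_eq_add_of_le hq
      rw [resultant_add_right_deg _ _ _ _ _ le_rfl] at hr
      exact (mul_eq_zero.mp hr).resolve_left (pow_ne_zero _ h)
    · obtain rfl : q.natDegree = n := le_antisymm hq (le_natDegree_of_ne_zero h)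
      obtain ⟨k, rfl⟩ := Nat.exists_eq_add_of_le hp
      rw [resultant_add_left_deg _ _ _ _ _ le_rfl] at hr
      exact (mul_eq_zero.mp hr).resolve_left (mul_ne_zero (by simp) (pow_ne_zero _ h))
  by_contra! hne
  refine (resultant_eq_zero_iff.mp key).2 ?_
  rw [isCoprime_iff_aeval_ne_zero_of_isAlgClosed (k := K) (K := K)]
  intro x
  by_cases hx : p.eval x = 0
  · right; simpa using hne x hx
  · left; simpa using hx

/-- The polynomial `s² f - c²` whose roots are the abscissae of the intersection points of the
curve `z² = f(x)` with the curve `c(x) + s z = 0`. -/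
def sexticPoly (f c : R[X]) (s : R) : R[X] := C s ^ 2 * f - c ^ 2

/-- The Jacobian `c f' - 2 c' f` of `f` and `c`, which vanishes at the ramification points
of `f / c²`. -/
def jacobianPoly (f c : R[X]) : R[X] := c * derivative f - 2 * derivative c * f

variable {f c : R[X]} {s : R}

theorem natDegree_sexticPoly_le (hf : f.natDegree ≤ 5) (hc : c.natDegree ≤ 3) :
    (sexticPoly f c s).natDegree ≤ 6 := by
  refine (natDegree_sub_le _ _).trans (max_le ?_ ?_)
  · rw [← C_pow]
    exact (natDegree_C_mul_le _ _).trans (hf.trans (by norm_num))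
  · exact natDegree_pow_le.trans (by omega)

theorem natDegree_jacobianPoly_le (hf : f.natDegree ≤ 5) (hc : c.natDegree ≤ 3) :
    (jacobianPoly f c).natDegree ≤ 7 := by
  have h1 := natDegree_derivative_le f
  have h2 := natDegree_derivative_le c
  refine (natDegree_sub_le _ _).trans (max_le ?_ ?_)
  · exact natDegree_mul_le.trans (by omega)
  · have : (2 * derivative c).natDegree ≤ (derivative c).natDegree := by
      rw [← map_ofNat (C : R →+* R[X]) 2]
      exact natDegree_C_mul_le _ _
    exact natDegree_mul_le.trans (by omega)

theorem derivative_sexticPoly :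
    derivative (sexticPoly f c s) = C s ^ 2 * derivative f - 2 * c * derivative c := by
  simp only [sexticPoly, ← C_pow, derivative_sub, derivative_C_mul, derivative_pow]
  simp [map_ofNat]

/-- The resultant of `G = s² f - c²` with `G'`, compared with its resultant with the Jacobian `J`
of `f` and `c`, by means of the identity `c G' = s² J + 2 c' G`. -/
theorem resultant_sexticPoly_derivative (hf : f.natDegree ≤ 5) (hc : c.natDegree ≤ 3) :
    s ^ 6 * resultant f c 6 3 *
        resultant (sexticPoly f c s) (derivative (sexticPoly f c s)) 6 5 =
      s ^ 12 * (sexticPoly f c s).coeff 6 *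
        resultant (sexticPoly f c s) (jacobianPoly f c) 6 7 := by
  set G := sexticPoly f c s with hG
  have hGd : G.natDegree ≤ 6 := natDegree_sexticPoly_le hf hc
  have hG'd : (derivative G).natDegree ≤ 5 := (natDegree_derivative_le _).trans (by omega)
  have hJ : (jacobianPoly f c).natDegree ≤ 7 := natDegree_jacobianPoly_le hf hc
  have hGc : resultant G c 6 3 = s ^ 6 * resultant f c 6 3 := by
    have : G = C (s ^ 2) * f + c * (-c) := by rw [hG, sexticPoly, C_pow]; ring
    rw [this, resultant_add_mul_left _ _ _ _ _ (by rw [natDegree_neg]; omega) hc,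
      resultant_C_mul_left]
    ring
  have h1 : resultant G (c * derivative G) 6 (3 + 5) =
      s ^ 6 * resultant f c 6 3 * resultant G (derivative G) 6 5 := by
    rw [resultant_mul_right_of_le _ _ _ hGd hc hG'd, hGc]
  have h2 : c * derivative G = C (s ^ 2) * jacobianPoly f c + G * (2 * derivative c) := by
    rw [derivative_sexticPoly, hG, sexticPoly, jacobianPoly, C_pow]; ring
  have h3 : (2 * derivative c).natDegree ≤ 2 := by
    rw [← map_ofNat (C : R →+* R[X]) 2]
    exact (natDegree_C_mul_le _ _).trans ((natDegree_derivative_le _).trans (by omega))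
  rw [← h1, h2, resultant_add_mul_right _ _ _ _ _ (by omega) hGd, resultant_C_mul_right,
    resultant_add_right_deg (n := 7) (k := 1) _ _ _ hJ]
  ring

/-- The resultant of `-c²` with the Jacobian of `f` and `c`, which governs the cubics with
`α₄ = 0`. -/
theorem resultant_neg_sq_jacobianPoly (hf : f.natDegree ≤ 5) (hc : c.natDegree ≤ 3) :
    c.coeff 3 ^ 2 * resultant (-c ^ 2) (jacobianPoly f c) 6 7 =
      -64 * resultant c (derivative c) 3 2 ^ 2 * resultant f c 6 3 ^ 2 := by
  have hJ : (jacobianPoly f c).natDegree ≤ 7 := natDegree_jacobianPoly_le hf hc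
  have hc' : (derivative c).natDegree ≤ 2 := (natDegree_derivative_le _).trans (by omega)
  have hf' : (derivative f).natDegree ≤ 4 := (natDegree_derivative_le _).trans (by omega)
  have h1 : resultant (-c ^ 2) (jacobianPoly f c) 6 7 =
      -resultant c (jacobianPoly f c) 3 7 ^ 2 := by
    rw [resultant_neg_left, sq, resultant_mul_left_of_le (m₁ := 3) (m₂ := 3) _ _ _ hJ hc hc]
    ring
  have h2 : c.coeff 3 * resultant c (jacobianPoly f c) 3 7 =
      -8 * resultant c (derivative c) 3 2 * resultant f c 6 3 := by
    have h3 := resultant_add_right_deg c (jacobianPoly f c) 3 7 1 hJ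
    have h4 : jacobianPoly f c = C (-2) * (derivative c * f) + c * derivative f := by
      rw [jacobianPoly, map_neg, map_ofNat]; ring
    have h5 := resultant_mul_right_of_le (m := 3) c (derivative c) f hc hc'
      (n₂ := 6) (hf.trans (by norm_num))
    rw [pow_one] at h3
    rw [← h3, h4, resultant_add_mul_right _ _ _ _ _ (by omega) hc, resultant_C_mul_right, h5,
      resultant_comm c f]
    ring
  rw [h1]
  linear_combination (-(c.coeff 3 * resultant c (jacobianPoly f c) 3 7) +
    8 * resultant c (derivative c) 3 2 * resultant f c 6 3) * h2

/-- For a polynomial `g` of formal degree `6`, the polynomial `6 g - (X - t) g'`; it corresponds to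
the derivative of the associated binary form in the direction `(t, 1)`. -/
def polarPoly (g : R[X]) (t : R) : R[X] := 6 * g - (X - C t) * derivative g

theorem natDegree_polarPoly_le {g : R[X]} (hg : g.natDegree ≤ 6) (t : R) :
    (polarPoly g t).natDegree ≤ 5 := by
  have hg' : (derivative g).natDegree ≤ 5 := (natDegree_derivative_le _).trans (by omega)
  rw [natDegree_le_iff_coeff_eq_zero]
  intro N hN
  obtain ⟨N, rfl⟩ : ∃ k, N = k + 1 := ⟨N - 1, by omega⟩
  rw [polarPoly, ← map_ofNat (C : R →+* R[X]) 6, sub_mul]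
  simp only [coeff_sub, coeff_C_mul, coeff_X_mul, coeff_derivative]
  rcases Nat.lt_or_ge 5 N with h | h
  · rw [coeff_eq_zero_of_natDegree_lt (by omega : g.natDegree < N + 1),
      coeff_eq_zero_of_natDegree_lt (by omega : g.natDegree < N + 1 + 1)]
    ring
  · obtain rfl : N = 5 := by omega
    rw [coeff_eq_zero_of_natDegree_lt (by omega : g.natDegree < 5 + 1 + 1)]
    push_cast
    ring

/-- For a sextic `g`, the discriminant times `g(t)` is, up to sign, the resultant of `g` with its
polar with respect to `t`. Unlike the resultant with `g'`, this is not divisible by the leading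
coefficient of `g`, so it can be specialised to sextics with a root at infinity. -/
theorem resultant_polarPoly [IsDomain R] {g : R[X]} (hg : g.natDegree = 6) (t : R) :
    resultant g (polarPoly g t) 6 5 = -(g.eval t * g.discr) := by
  have hg6 : g.natDegree ≤ 6 := hg.le
  have hg' : (derivative g).natDegree ≤ 5 := (natDegree_derivative_le _).trans (by omega)
  have hlead : g.coeff 6 ≠ 0 := by
    rw [← hg, coeff_natDegree, leadingCoeff_ne_zero]
    rintro rfl
    simp at hg
  have h1 : resultant g (derivative g) 6 5 = -(g.coeff 6 * g.discr) := by
    have := resultant_deriv (f := g) (natDegree_pos_iff_degree_pos.mp (by omega))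
    rw [leadingCoeff, hg] at this
    norm_num at this
    exact this
  have h2 : resultant g ((X - C t) * derivative g) 6 (1 + 5) =
      g.eval t * resultant g (derivative g) 6 5 := by
    rw [resultant_mul_right_of_le _ _ _ hg6 (natDegree_X_sub_C_le t) hg',
      resultant_X_sub_C_right _ _ _ hg6]
    norm_num
  have h3 : (X - C t) * derivative g = -polarPoly g t + g * C 6 := by
    rw [polarPoly, map_ofNat]; ring
  rw [h3, resultant_add_mul_right _ _ _ _ _ (by simp) hg6, resultant_neg_right,
    show (1 + 5) = 5 + 1 by norm_num, resultant_add_right_deg _ _ _ _ _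
      (natDegree_polarPoly_le hg6 t), h1] at h2
  refine mul_left_cancel₀ hlead ?_
  linear_combination h2

end Resultants

/-! ### The discriminant and its quotient by the sixth power of the last coordinate -/

section Discriminant

open Polynomial

/-- The cubic polynomial `a₀ x³ + a₁ x² + a₂ x + a₃`. -/
def cubicPoly {R : Type*} [CommRing R] (a : Fin 5 → R) : R[X] :=
  C (a 0) * X ^ 3 + C (a 1) * X ^ 2 + C (a 2) * X + C (a 3)

section cubicPoly

theorem resultant_prod_X_sub_C {R ι : Type*} [CommRing R] (s : Finset ι) (r : ι → R) {g : R[X]}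
    {n : ℕ} (hg : g.natDegree ≤ n) :
    resultant (∏ i ∈ s, (X - C (r i))) g s.card n = ∏ i ∈ s, g.eval (r i) := by
  classical
  induction s using Finset.induction_on with
  | empty => simp
  | insert i s hi ih =>
    rw [Finset.prod_insert hi, Finset.prod_insert hi, Finset.card_insert_of_notMem hi, add_comm,
      resultant_mul_left_of_le _ _ _ hg (natDegree_X_sub_C_le _)
        ((natDegree_prod_le _ _).trans ((Finset.sum_le_card_nsmul s _ 1
          fun i _ => natDegree_X_sub_C_le _).trans (by simp))), ih,
      resultant_X_sub_C_left _ _ _ hg]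

variable {R S : Type*} [CommRing R] [CommRing S]

theorem map_prod_X_sub_C {ι : Type*} (φ : R →+* S) (s : Finset ι) (r : ι → R) :
    (∏ i ∈ s, (X - C (r i))).map φ = ∏ i ∈ s, (X - C (φ (r i))) := by
  simp [Polynomial.map_prod]

theorem cubicPoly_map (φ : R →+* S) (a : Fin 5 → R) :
    (cubicPoly a).map φ = cubicPoly fun i => φ (a i) := by
  simp [cubicPoly]

theorem natDegree_cubicPoly_le (a : Fin 5 → R) : (cubicPoly a).natDegree ≤ 3 := by
  rw [cubicPoly]; compute_degree

theorem coeff_cubicPoly_three (a : Fin 5 → R) : (cubicPoly a).coeff 3 = a 0 := by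
  simp [cubicPoly]

theorem eval_cubicPoly (a : Fin 5 → R) (x : R) :
    (cubicPoly a).eval x = a 0 * x ^ 3 + a 1 * x ^ 2 + a 2 * x + a 3 := by
  simp [cubicPoly]

theorem eval_derivative_cubicPoly (a : Fin 5 → R) (x : R) :
    (derivative (cubicPoly a)).eval x = 3 * a 0 * x ^ 2 + 2 * a 1 * x + a 2 := by
  simp [cubicPoly]; ring

theorem sexticPoly_map (φ : R →+* S) (f c : R[X]) (s : R) :
    (sexticPoly f c s).map φ = sexticPoly (f.map φ) (c.map φ) (φ s) := by
  simp [sexticPoly]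

theorem jacobianPoly_map (φ : R →+* S) (f c : R[X]) :
    (jacobianPoly f c).map φ = jacobianPoly (f.map φ) (c.map φ) := by
  simp [jacobianPoly, derivative_map]

theorem polarPoly_map (φ : R →+* S) (g : R[X]) (t : R) :
    (polarPoly g t).map φ = polarPoly (g.map φ) (φ t) := by
  simp [polarPoly, derivative_map]

theorem cubicPoly_ne_zero {a : Fin 5 → ℂ} (ha : a ≠ 0) (h4 : a 4 = 0) : cubicPoly a ≠ 0 := by
  intro h
  refine ha (funext fun i => ?_)
  have h0 := congrArg (fun p : ℂ[X] => p.coeff 0) h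
  have h1 := congrArg (fun p : ℂ[X] => p.coeff 1) h
  have h2 := congrArg (fun p : ℂ[X] => p.coeff 2) h
  have h3 := congrArg (fun p : ℂ[X] => p.coeff 3) h
  simp [cubicPoly, coeff_X, coeff_C] at h0 h1 h2 h3
  fin_cases i
  all_goals simp [*]

end cubicPoly

/-- The abscissae `0, 1, l₀, l₁, l₂` of the five affine branch points of `C → ℙ¹`. -/
def branchPoint (l : Fin 3 → ℂ) : Fin 5 → ℂ := ![0, 1, l 0, l 1, l 2]

theorem affineSextic_eq_prod (l : Fin 3 → ℂ) :
    affineSextic l = ∏ i, (X - C (branchPoint l i)) := by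
  simp [affineSextic, sexticForm, Fin.prod_univ_succ, branchPoint]
  ring

theorem natDegree_affineSextic (l : Fin 3 → ℂ) : (affineSextic l).natDegree = 5 := by
  rw [affineSextic_eq_prod, natDegree_prod_of_monic _ _ fun i _ => monic_X_sub_C _]
  simp

theorem monic_affineSextic (l : Fin 3 → ℂ) : (affineSextic l).Monic := by
  rw [affineSextic_eq_prod]
  exact monic_prod_of_monic _ _ fun i _ => monic_X_sub_C _

theorem branchPoint_injective {l : Fin 3 → ℂ} (hl : Function.Injective l) (hl0 : ∀ i, l i ≠ 0)
    (hl1 : ∀ i, l i ≠ 1) : Function.Injective (branchPoint l) := by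
  have h01 := hl.ne (show (0 : Fin 3) ≠ 1 by decide)
  have h02 := hl.ne (show (0 : Fin 3) ≠ 2 by decide)
  have h12 := hl.ne (show (1 : Fin 3) ≠ 2 by decide)
  have hl0' := fun i => (hl0 i).symm
  have hl1' := fun i => (hl1 i).symm
  intro i j h
  fin_cases i <;> fin_cases j <;> first
    | rfl
    | simp [branchPoint, hl0, hl1, hl0', hl1', h01, h02, h12, h01.symm, h02.symm, h12.symm] at h

theorem eval_affineSextic_eq_zero_iff (l : Fin 3 → ℂ) (x : ℂ) :
    (affineSextic l).eval x = 0 ↔ ∃ i, x = branchPoint l i := by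
  simp [affineSextic_eq_prod, eval_prod, Finset.prod_eq_zero_iff, sub_eq_zero]

theorem separable_affineSextic {l : Fin 3 → ℂ} (hl : Function.Injective (branchPoint l)) :
    (affineSextic l).Separable := by
  rw [affineSextic_eq_prod]
  exact separable_prod_X_sub_C_iff.mpr hl

theorem eval_derivative_affineSextic_ne_zero {l : Fin 3 → ℂ}
    (hl : Function.Injective (branchPoint l)) {x : ℂ} (hx : (affineSextic l).eval x = 0) :
    (derivative (affineSextic l)).eval x ≠ 0 := by
  have := (separable_affineSextic hl).eval₂_derivative_ne_zero (RingHom.id ℂ) (x := x)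
  simpa [eval₂_id] using this (by simpa [eval₂_id] using hx)

variable (l : Fin 3 → ℂ)

/-- The ring `ℂ[α₀, …, α₄]`. -/
local notation "A" => MvPolynomial (Fin 5) ℂ

/-- The generic cubic polynomial `α₀ x³ + α₁ x² + α₂ x + α₃`. -/
def genericCubic : A[X] := cubicPoly MvPolynomial.X

theorem resultantPoly_eq :
    resultantPoly l =
      sexticPoly ((affineSextic l).map MvPolynomial.C) genericCubic (MvPolynomial.X 4) := rfl

theorem natDegree_genericCubic_le : genericCubic.natDegree ≤ 3 := natDegree_cubicPoly_le _

theorem coeff_genericCubic_three : genericCubic.coeff 3 = MvPolynomial.X 0 :=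
  coeff_cubicPoly_three _

theorem genericCubic_map_eval (a : Fin 5 → ℂ) :
    genericCubic.map (MvPolynomial.eval a) = cubicPoly a := by
  simp [genericCubic, cubicPoly_map]

theorem map_C_map_eval (f : ℂ[X]) (a : Fin 5 → ℂ) :
    (f.map (MvPolynomial.C : ℂ →+* A)).map (MvPolynomial.eval a) = f := by
  have : (MvPolynomial.eval a).comp (MvPolynomial.C : ℂ →+* A) = RingHom.id ℂ :=
    RingHom.ext fun x => MvPolynomial.eval_C (f := a) x
  rw [Polynomial.map_map, this, Polynomial.map_id]

theorem resultantPoly_map_eval (a : Fin 5 → ℂ) :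
    (resultantPoly l).map (MvPolynomial.eval a) =
      sexticPoly (affineSextic l) (cubicPoly a) (a 4) := by
  rw [resultantPoly_eq, sexticPoly_map, map_C_map_eval, genericCubic_map_eval, MvPolynomial.eval_X]

theorem natDegree_map_affineSextic_le :
    ((affineSextic l).map (MvPolynomial.C : ℂ →+* A)).natDegree ≤ 5 :=
  natDegree_map_le.trans (natDegree_affineSextic l).le

theorem coeff_six_sexticPoly {R : Type*} [CommRing R] {f : R[X]} (hf : f.natDegree ≤ 5)
    (a : Fin 5 → R) (s : R) : (sexticPoly f (cubicPoly a) s).coeff 6 = -a 0 ^ 2 := by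
  rw [sexticPoly, ← C_pow, coeff_sub, coeff_C_mul, coeff_eq_zero_of_natDegree_lt (by omega),
    show 6 = 2 * 3 by rfl, coeff_pow_of_natDegree_le (natDegree_cubicPoly_le a),
    coeff_cubicPoly_three]
  simp

theorem coeff_six_resultantPoly : (resultantPoly l).coeff 6 = -MvPolynomial.X 0 ^ 2 :=
  coeff_six_sexticPoly (natDegree_map_affineSextic_le l) _ _

theorem natDegree_resultantPoly : (resultantPoly l).natDegree = 6 := by
  refine le_antisymm (natDegree_sexticPoly_le (natDegree_map_affineSextic_le l)
    (natDegree_cubicPoly_le _)) (le_natDegree_of_ne_zero ?_)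
  rw [coeff_six_resultantPoly]
  exact neg_ne_zero.mpr (pow_ne_zero _ (MvPolynomial.X_ne_zero 0))

/-- The resultant of `f` and the generic cubic: up to sign, the product of the six linear forms in
`α₀, …, α₃` that express that a cubic passes through one of the six Weierstrass points of `C`, where
`z = 0`. The formal degree of `f` is `6`, which accounts for the Weierstrass point at infinity. -/
def weierstrassProduct : A := resultant ((affineSextic l).map MvPolynomial.C) genericCubic 6 3

theorem weierstrassProduct_eq :
    weierstrassProduct l = -(MvPolynomial.X 0 *
      ∏ i, (genericCubic.eval (MvPolynomial.C (branchPoint l i)))) := by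
  have h1 := resultant_add_left_deg _ genericCubic 5 3 1 (natDegree_map_affineSextic_le l)
  have h2 : resultant ((affineSextic l).map (MvPolynomial.C : ℂ →+* A)) genericCubic 5 3 =
      ∏ i, (genericCubic.eval (MvPolynomial.C (branchPoint l i))) := by
    have := resultant_prod_X_sub_C Finset.univ
      (fun i => (MvPolynomial.C (branchPoint l i) : A)) natDegree_genericCubic_le
    rw [Finset.card_univ, Fintype.card_fin] at this
    rw [← this, affineSextic_eq_prod, map_prod_X_sub_C]
  rw [weierstrassProduct, h1, h2, coeff_genericCubic_three]
  ring

/-- The substitution `α₄ = 0`. -/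
def restrict : A →ₐ[ℂ] A := MvPolynomial.aeval fun i => if i = 4 then 0 else MvPolynomial.X i

theorem restrict_X_four : restrict (MvPolynomial.X 4) = 0 := by simp [restrict]

theorem eval_restrict {a : Fin 5 → ℂ} (h : a 4 = 0) (p : A) :
    MvPolynomial.eval a (restrict p) = MvPolynomial.eval a p := by
  have : ((MvPolynomial.aeval a).comp restrict : A →ₐ[ℂ] ℂ) = MvPolynomial.aeval a := by
    refine MvPolynomial.algHom_ext fun i => ?_
    simp only [restrict, AlgHom.comp_apply, MvPolynomial.aeval_X]
    split_ifs with hi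
    · simp [hi, h]
    · simp
  simpa [MvPolynomial.coe_aeval_eq_eval] using DFunLike.congr_fun this p

theorem genericCubic_map_restrict :
    genericCubic.map (restrict : A →+* A) = genericCubic := by
  rw [genericCubic, cubicPoly_map]
  simp [cubicPoly, restrict]

theorem map_C_map_restrict (f : ℂ[X]) :
    (f.map (MvPolynomial.C : ℂ →+* A)).map (restrict : A →+* A) = f.map MvPolynomial.C := by
  rw [Polynomial.map_map]
  congr 1
  ext : 1
  simp [restrict]

theorem resultantPoly_map_restrict :
    (resultantPoly l).map (restrict : A →+* A) = -genericCubic ^ 2 := by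
  have : (restrict : A →+* A) (MvPolynomial.X 4) = 0 := restrict_X_four
  rw [resultantPoly_eq, sexticPoly_map, map_C_map_restrict, genericCubic_map_restrict, this,
    sexticPoly]
  simp

theorem restrict_weierstrassProduct :
    restrict (weierstrassProduct l) = weierstrassProduct l := by
  have := resultant_map_map ((affineSextic l).map (MvPolynomial.C : ℂ →+* A)) genericCubic 6 3
    (restrict : A →+* A)
  rw [genericCubic_map_restrict, map_C_map_restrict] at this
  exact this.symm

/-- There is a cubic with `α₄ = 0` that meets `C` at the Weierstrass point `(0, 0)`, and is
otherwise as general as possible. -/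
theorem exists_general_cubic :
    ∃ a : Fin 5 → ℂ, a 0 ≠ 0 ∧ a 3 = 0 ∧ a 4 = 0 ∧
      (∀ i, branchPoint l i ≠ 0 → (cubicPoly a).eval (branchPoint l i) ≠ 0) ∧
      ∀ x, (cubicPoly a).eval x = 0 → (derivative (cubicPoly a)).eval x ≠ 0 := by
  obtain ⟨p, hp⟩ := (Set.finite_range (branchPoint l)).exists_notMem
  obtain ⟨q, hq⟩ := ((Set.finite_range (branchPoint l)).insert p).exists_notMem
  have h0 : (0 : ℂ) ∈ Set.range (branchPoint l) := ⟨0, rfl⟩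
  have hp0 : p ≠ 0 := fun h => hp (h ▸ h0)
  have hq0 : q ≠ 0 := fun h => hq (Or.inr (h ▸ h0))
  have hqp : q ≠ p := fun h => hq (Or.inl h)
  have ev (x : ℂ) : (cubicPoly ![1, -(p + q), p * q, 0, 0]).eval x = x * (x - p) * (x - q) := by
    rw [eval_cubicPoly]; simp; ring
  refine ⟨![1, -(p + q), p * q, 0, 0], by simp, by simp, by simp, fun i hi => ?_, fun x hx => ?_⟩
  · rw [ev]
    refine mul_ne_zero (mul_ne_zero hi (sub_ne_zero.mpr ?_)) (sub_ne_zero.mpr ?_)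
    · exact fun h => hp ⟨i, h⟩
    · exact fun h => hq (Or.inr ⟨i, h⟩)
  · rw [ev] at hx
    rw [eval_derivative_cubicPoly]
    simp only [mul_eq_zero, sub_eq_zero] at hx
    have h1 : (p : ℂ) * q ≠ 0 := mul_ne_zero hp0 hq0
    have h2 : p * (p - q) ≠ 0 := mul_ne_zero hp0 (sub_ne_zero.mpr hqp.symm)
    have h3 : q * (q - p) ≠ 0 := mul_ne_zero hq0 (sub_ne_zero.mpr hqp)
    rcases hx with (rfl | rfl) | rfl
    · simpa using h1
    · convert h2 using 1; simp; ring
    · convert h3 using 1; simp; ring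

theorem discr_genericCubic :
    resultant genericCubic (derivative genericCubic) 3 2 =
      -(MvPolynomial.X 0 * genericCubic.discr) := by
  have hd : genericCubic.natDegree = 3 :=
    le_antisymm (natDegree_cubicPoly_le _) (le_natDegree_of_ne_zero (by
      rw [coeff_genericCubic_three]; exact MvPolynomial.X_ne_zero 0))
  have := resultant_deriv (f := genericCubic) (natDegree_pos_iff_degree_pos.mp (by omega))
  rw [leadingCoeff, hd, coeff_genericCubic_three] at this
  norm_num at this
  exact this

theorem eval_discr_genericCubic_eq_zero_iff {a : Fin 5 → ℂ} (h0 : a 0 ≠ 0) :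
    MvPolynomial.eval a genericCubic.discr = 0 ↔
      ∃ x, (cubicPoly a).eval x = 0 ∧ (derivative (cubicPoly a)).eval x = 0 := by
  have hc := natDegree_cubicPoly_le a
  have hc' : (derivative (cubicPoly a)).natDegree ≤ 2 :=
    (natDegree_derivative_le _).trans (by omega)
  have h1 : resultant (cubicPoly a) (derivative (cubicPoly a)) 3 2 =
      -(a 0 * MvPolynomial.eval a genericCubic.discr) := by
    have := congrArg (MvPolynomial.eval a) discr_genericCubic
    rw [← resultant_map_map, ← derivative_map, genericCubic_map_eval] at this
    simpa using this
  constructor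
  · intro h
    refine exists_common_root_of_resultant_eq_zero hc hc' (Or.inl ?_) (by rw [h1, h]; simp)
    rwa [coeff_cubicPoly_three]
  · rintro ⟨x, hx, hx'⟩
    rw [resultant_eq_zero_of_common_root hc hc' (by simp) hx hx'] at h1
    simpa [h0] using h1.symm

theorem eval_eval_C (p : A[X]) (a : Fin 5 → ℂ) (x : ℂ) :
    MvPolynomial.eval a (p.eval (MvPolynomial.C x)) = (p.map (MvPolynomial.eval a)).eval x := by
  rw [eval_map, ← MvPolynomial.eval_C (f := a) x, eval₂_at_apply, MvPolynomial.eval_C]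

theorem eval_genericCubic (a : Fin 5 → ℂ) (x : ℂ) :
    MvPolynomial.eval a (genericCubic.eval (MvPolynomial.C x)) = (cubicPoly a).eval x := by
  rw [eval_eval_C, genericCubic_map_eval]

theorem eval_weierstrassProduct (a : Fin 5 → ℂ) :
    MvPolynomial.eval a (weierstrassProduct l) =
      -(a 0 * ∏ i, (cubicPoly a).eval (branchPoint l i)) := by
  rw [weierstrassProduct_eq, map_neg, map_mul, MvPolynomial.eval_X, map_prod]
  simp only [eval_genericCubic]

theorem exists_eval_weierstrassProduct_ne_zero :
    ∃ a : Fin 5 → ℂ, MvPolynomial.eval a (weierstrassProduct l) ≠ 0 := by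
  obtain ⟨t, ht⟩ := (Set.finite_range (branchPoint l)).exists_notMem
  refine ⟨![1, -3 * t, 3 * t ^ 2, -t ^ 3, 0], ?_⟩
  rw [eval_weierstrassProduct]
  have ev (x : ℂ) : (cubicPoly ![1, -3 * t, 3 * t ^ 2, -t ^ 3, 0]).eval x = (x - t) ^ 3 := by
    rw [eval_cubicPoly]; simp; ring
  simp only [ev, neg_ne_zero]
  refine mul_ne_zero (by simp) (Finset.prod_ne_zero_iff.mpr fun i _ => pow_ne_zero _ ?_)
  exact sub_ne_zero.mpr fun h => ht ⟨i, h⟩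

theorem weierstrassProduct_ne_zero : weierstrassProduct l ≠ 0 := by
  obtain ⟨a, ha⟩ := exists_eval_weierstrassProduct_ne_zero l
  exact fun h => ha (by simp [h])

/-- This is `resultant_sexticPoly_derivative` for the generic cubic, with the common factor `α₀² α₄⁶`
of the two sides cancelled. -/
theorem discr_mul_weierstrassProduct :
    (resultantPoly l).discr * weierstrassProduct l = -(MvPolynomial.X 4 ^ 6 *
      resultant (resultantPoly l) (jacobianPoly ((affineSextic l).map MvPolynomial.C) genericCubic)
        6 7) := by
  have h1 := resultant_sexticPoly_derivative (s := (MvPolynomial.X 4 : A))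
    (natDegree_map_affineSextic_le l) natDegree_genericCubic_le
  have h2 := resultant_deriv (f := resultantPoly l)
    (natDegree_pos_iff_degree_pos.mp (by rw [natDegree_resultantPoly]; omega))
  rw [leadingCoeff, natDegree_resultantPoly, coeff_six_resultantPoly] at h2
  norm_num at h2
  change _ * weierstrassProduct l * resultant (resultantPoly l) (derivative (resultantPoly l)) 6 5 =
    _ * (resultantPoly l).coeff 6 * resultant (resultantPoly l) _ 6 7 at h1
  rw [h2, coeff_six_resultantPoly] at h1
  have h0 : (MvPolynomial.X 4 ^ 6 * MvPolynomial.X 0 ^ 2 : A) ≠ 0 :=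
    mul_ne_zero (pow_ne_zero _ (MvPolynomial.X_ne_zero 4))
      (pow_ne_zero _ (MvPolynomial.X_ne_zero 0))
  refine mul_left_cancel₀ h0 ?_
  linear_combination h1

theorem exists_mul_eq_discr_resultantPoly :
    ∃ F : A, MvPolynomial.X 4 ^ 6 * F = (resultantPoly l).discr := by
  have hX : Prime (MvPolynomial.X 4 : A) := MvPolynomial.X_prime
  have h1 : ¬ (MvPolynomial.X 4 : A) ∣ weierstrassProduct l := by
    rintro ⟨q, hq⟩
    have := congrArg restrict hq
    rw [restrict_weierstrassProduct, map_mul, restrict_X_four, zero_mul] at this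
    exact weierstrassProduct_ne_zero l this
  obtain ⟨F, hF⟩ := hX.pow_dvd_of_dvd_mul_right 6 h1
    ⟨_, (discr_mul_weierstrassProduct l).trans (mul_neg _ _).symm⟩
  exact ⟨F, hF.symm⟩

/-! ### The quotient of the discriminant -/

variable {l} {F : MvPolynomial (Fin 5) ℂ}

theorem mul_weierstrassProduct (hF : MvPolynomial.X 4 ^ 6 * F = (resultantPoly l).discr) :
    F * weierstrassProduct l = -resultant (resultantPoly l)
      (jacobianPoly ((affineSextic l).map MvPolynomial.C) genericCubic) 6 7 := by
  have h0 : (MvPolynomial.X 4 ^ 6 : A) ≠ 0 := pow_ne_zero _ (MvPolynomial.X_ne_zero 4)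
  refine mul_left_cancel₀ h0 ?_
  linear_combination discr_mul_weierstrassProduct l + weierstrassProduct l * hF

/-- The restriction of `F` to the hyperplane `α₄ = 0` of cubics that are unions of three fibres of
`C → ℙ¹`: such a cubic is tangent to `C` if one of the fibres lies over a branch point or if two of
the fibres coincide. -/
theorem restrict_eq (hF : MvPolynomial.X 4 ^ 6 * F = (resultantPoly l).discr) :
    restrict F = 64 * genericCubic.discr ^ 2 * weierstrassProduct l := by
  have h1 := congrArg restrict (mul_weierstrassProduct hF)
  have h2 := resultant_map_map (resultantPoly l)
    (jacobianPoly ((affineSextic l).map MvPolynomial.C) genericCubic) 6 7 (restrict : A →+* A)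
  have h3 := resultant_neg_sq_jacobianPoly (natDegree_map_affineSextic_le l)
    natDegree_genericCubic_le
  rw [← weierstrassProduct] at h3
  rw [discr_genericCubic, coeff_genericCubic_three] at h3
  rw [resultantPoly_map_restrict, jacobianPoly_map, map_C_map_restrict,
    genericCubic_map_restrict] at h2
  rw [map_mul, restrict_weierstrassProduct, map_neg] at h1
  have h5 : restrict F * weierstrassProduct l =
      -resultant (-genericCubic ^ 2)
        (jacobianPoly ((affineSextic l).map MvPolynomial.C) genericCubic) 6 7 :=
    h1.trans (congrArg Neg.neg h2.symm)
  have h0 : (MvPolynomial.X 0 ^ 2 : A) ≠ 0 := pow_ne_zero _ (MvPolynomial.X_ne_zero 0)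
  refine mul_left_cancel₀ h0 (mul_right_cancel₀ (weierstrassProduct_ne_zero l) ?_)
  linear_combination MvPolynomial.X 0 ^ 2 * h5 - h3

/-- The points of `F = 0` on the hyperplane `α₄ = 0`. -/
theorem eval_eq_zero_iff_of_eq_zero (hF : MvPolynomial.X 4 ^ 6 * F = (resultantPoly l).discr)
    {a : Fin 5 → ℂ} (h4 : a 4 = 0) :
    MvPolynomial.eval a F = 0 ↔ a 0 = 0 ∨ (∃ i, (cubicPoly a).eval (branchPoint l i) = 0) ∨
      ∃ x, (cubicPoly a).eval x = 0 ∧ (derivative (cubicPoly a)).eval x = 0 := by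
  rw [← eval_restrict h4, restrict_eq hF, map_mul, map_mul, map_pow, eval_weierstrassProduct]
  by_cases h0 : a 0 = 0
  · simp [h0]
  rw [← eval_discr_genericCubic_eq_zero_iff h0]
  simp [h0, Finset.prod_eq_zero_iff]
  tauto

theorem natDegree_cubicPoly_le_two {a : Fin 5 → ℂ} (h0 : a 0 = 0) :
    (cubicPoly a).natDegree ≤ 2 := by
  rw [cubicPoly, h0]; simp only [map_zero, zero_mul, zero_add]; compute_degree

theorem coeff_five_sexticPoly (l : Fin 3 → ℂ) {a : Fin 5 → ℂ} (h0 : a 0 = 0) :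
    (sexticPoly (affineSextic l) (cubicPoly a) (a 4)).coeff 5 = a 4 ^ 2 := by
  have h1 : (affineSextic l).coeff 5 = 1 := by
    have := monic_affineSextic l
    rwa [Monic, leadingCoeff, natDegree_affineSextic] at this
  have h2 := natDegree_cubicPoly_le_two h0
  rw [sexticPoly, ← C_pow, coeff_sub, coeff_C_mul, h1,
    coeff_eq_zero_of_natDegree_lt (natDegree_pow_le.trans_lt (by omega))]
  simp

/-- The points of `F = 0` outside the hyperplane `α₄ = 0`. -/
theorem eval_eq_zero_iff_of_ne_zero (hF : MvPolynomial.X 4 ^ 6 * F = (resultantPoly l).discr)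
    {a : Fin 5 → ℂ} (h4 : a 4 ≠ 0) :
    MvPolynomial.eval a F = 0 ↔ ∃ x, (sexticPoly (affineSextic l) (cubicPoly a) (a 4)).eval x = 0 ∧
      (derivative (sexticPoly (affineSextic l) (cubicPoly a) (a 4))).eval x = 0 := by
  set G := sexticPoly (affineSextic l) (cubicPoly a) (a 4) with hG
  have hf : (affineSextic l).natDegree ≤ 5 := (natDegree_affineSextic l).le
  have hGd : G.natDegree ≤ 6 := natDegree_sexticPoly_le hf (natDegree_cubicPoly_le a)
  have hG6 : G.coeff 6 = -a 0 ^ 2 := coeff_six_sexticPoly hf a (a 4)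
  have hG5 : a 0 = 0 → G.coeff 5 = a 4 ^ 2 := coeff_five_sexticPoly l
  have hG0 : G ≠ 0 := by
    intro h
    rw [h] at hG6 hG5
    by_cases h0 : a 0 = 0
    · exact h4 (by simpa using (hG5 h0).symm)
    · exact h0 (by simpa using hG6.symm)
  -- the resultant with the polar at `t` is `- G(t) Disc(G)`, also if `G` has a root at infinity
  obtain ⟨t, ht⟩ : ∃ t, G.eval t ≠ 0 := by
    by_contra! h
    exact hG0 (Polynomial.funext (by simpa using h))
  have hE := resultant_polarPoly (natDegree_resultantPoly l) (MvPolynomial.C t)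
  have hE' := congrArg (MvPolynomial.eval a) hE
  rw [← resultant_map_map, polarPoly_map, resultantPoly_map_eval, MvPolynomial.eval_C, ← hG,
    map_neg, map_mul, ← hF, map_mul] at hE'
  have ht' : MvPolynomial.eval a ((resultantPoly l).eval (MvPolynomial.C t)) = G.eval t := by
    rw [hG, ← resultantPoly_map_eval, eval_eval_C]
  have hP : (polarPoly G t).natDegree ≤ 5 := natDegree_polarPoly_le hGd t
  have hPx (x : ℂ) : (polarPoly G t).eval x = 6 * G.eval x - (x - t) * (derivative G).eval x := by
    simp [polarPoly]
  rw [ht'] at hE'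
  constructor
  · intro h
    rw [h, mul_zero, mul_zero, neg_zero] at hE'
    obtain ⟨x, hx, hx'⟩ := exists_common_root_of_resultant_eq_zero hGd hP (by
      by_cases h0 : a 0 = 0
      · right
        rw [h0] at hG6
        rw [polarPoly, ← map_ofNat (C : ℂ →+* ℂ[X]) 6, sub_mul]
        simp only [coeff_sub, coeff_C_mul, coeff_X_mul, coeff_derivative, hG5 h0, hG6]
        have : (6 * a 4 ^ 2 - (a 4 ^ 2 * (4 + 1) - t * (-0 ^ 2 * (5 + 1))) : ℂ) = a 4 ^ 2 := by ring
        push_cast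
        rw [this]
        exact pow_ne_zero 2 h4
      · left
        simpa [hG6] using h0) hE'
    refine ⟨x, hx, ?_⟩
    rw [hPx, hx, mul_zero, zero_sub, neg_eq_zero, mul_eq_zero, sub_eq_zero] at hx'
    exact hx'.resolve_left fun h => ht (h ▸ hx)
  · rintro ⟨x, hx, hx'⟩
    rw [resultant_eq_zero_of_common_root hGd hP (by simp) hx (by rw [hPx, hx, hx']; ring)] at hE'
    simpa [ht, h4] using hE'.symm

end Discriminant

/-! ### Homogeneity -/

section Homogeneity

theorem IsHomogeneous.det {σ R ι : Type*} [CommRing R] [Fintype ι] [DecidableEq ι] {d : ℕ}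
    {M : Matrix ι ι (MvPolynomial σ R)} (h : ∀ i j, (M i j).IsHomogeneous d) :
    M.det.IsHomogeneous (Fintype.card ι * d) := by
  rw [Matrix.det_apply]
  refine MvPolynomial.IsHomogeneous.sum _ _ _ fun τ _ => ?_
  have h1 : (∏ i, M (τ i) i).IsHomogeneous (Fintype.card ι * d) := by
    have := MvPolynomial.IsHomogeneous.prod Finset.univ (fun i => M (τ i) i) (fun _ => d)
      fun i _ => h _ _
    simpa using this
  rcases Int.units_eq_one_or (Equiv.Perm.sign τ) with hs | hs <;> rw [hs]
  · simpa using h1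
  · simpa using h1.neg

theorem IsHomogeneous.of_X_mul {σ R : Type*} [CommRing R] {p : MvPolynomial σ R} {i : σ} {n : ℕ}
    (h : (MvPolynomial.X i * p).IsHomogeneous (n + 1)) : p.IsHomogeneous n := by
  intro d hd
  have := h (d := Finsupp.single i 1 + d) (by rwa [MvPolynomial.coeff_X_mul])
  rw [map_add] at this
  simp only [Finsupp.weight_single, Pi.one_apply, smul_eq_mul, mul_one] at this
  omega

theorem IsHomogeneous.of_X_pow_mul {σ R : Type*} [CommRing R] {p : MvPolynomial σ R} {i : σ}
    {n k : ℕ} (h : (MvPolynomial.X i ^ k * p).IsHomogeneous (n + k)) : p.IsHomogeneous n := by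
  induction k with
  | zero => simpa using h
  | succ k ih =>
    rw [pow_succ', mul_assoc, ← add_assoc] at h
    exact ih (of_X_mul h)

variable {l : Fin 3 → ℂ} {F : MvPolynomial (Fin 5) ℂ}

theorem isHomogeneous_coeff_resultantPoly (l : Fin 3 → ℂ) (k : ℕ) :
    ((resultantPoly l).coeff k).IsHomogeneous 2 := by
  have hc (j : ℕ) : (genericCubic.coeff j).IsHomogeneous 1 := by
    have h0 : (0 : MvPolynomial (Fin 5) ℂ).IsHomogeneous 1 := MvPolynomial.isHomogeneous_zero _ _ _
    have hX (i : Fin 5) := MvPolynomial.isHomogeneous_X ℂ i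
    simp only [genericCubic, cubicPoly, Polynomial.coeff_add, Polynomial.coeff_C_mul,
      Polynomial.coeff_X_pow, Polynomial.coeff_X, Polynomial.coeff_C]
    refine ((MvPolynomial.IsHomogeneous.add ?_ ?_).add ?_).add ?_ <;> split_ifs <;>
      simp [hX, h0]
  rw [resultantPoly_eq, sexticPoly, ← Polynomial.C_pow, Polynomial.coeff_sub,
    Polynomial.coeff_C_mul, Polynomial.coeff_map, mul_comm, sq genericCubic, Polynomial.coeff_mul]
  refine MvPolynomial.IsHomogeneous.sub ?_ (MvPolynomial.IsHomogeneous.sum _ _ _ fun _ _ => ?_)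
  · exact (MvPolynomial.isHomogeneous_X_pow _ _).C_mul _
  · exact (hc _).mul (hc _)

theorem isHomogeneous_of_mul_eq_discr
    (hF : MvPolynomial.X 4 ^ 6 * F = (resultantPoly l).discr) : F.IsHomogeneous 14 := by
  set G := resultantPoly l with hG
  -- this resultant is `α₀² α₄⁶ F`, and `22 = 2 + 6 + 14`
  have h1 : (Polynomial.resultant G (Polynomial.derivative G) 6 5).IsHomogeneous (11 * 2) := by
    refine IsHomogeneous.det (ι := Fin 11) (M := Polynomial.sylvester G _ 6 5) fun i j => ?_
    have h0 : (0 : MvPolynomial (Fin 5) ℂ).IsHomogeneous 2 := MvPolynomial.isHomogeneous_zero _ _ _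
    have hd (k : ℕ) : ((Polynomial.derivative G).coeff k).IsHomogeneous 2 := by
      rw [Polynomial.coeff_derivative, mul_comm]
      exact_mod_cast (isHomogeneous_coeff_resultantPoly l (k + 1)).C_mul ((k : ℂ) + 1)
    rw [Polynomial.sylvester, Matrix.of_apply]
    induction j using Fin.addCases (m := 6) (n := 5) with
    | left j =>
      rw [Fin.addCases_left]
      split_ifs
      · exact hd _
      · exact h0
    | right j =>
      rw [Fin.addCases_right]
      split_ifs
      · exact isHomogeneous_coeff_resultantPoly l _
      · exact h0
  have h2 := Polynomial.resultant_deriv (f := G)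
    (Polynomial.natDegree_pos_iff_degree_pos.mp (by rw [hG, natDegree_resultantPoly]; omega))
  rw [Polynomial.leadingCoeff, hG, natDegree_resultantPoly, coeff_six_resultantPoly, ← hF] at h2
  norm_num at h2
  rw [hG, h2] at h1
  exact IsHomogeneous.of_X_pow_mul (IsHomogeneous.of_X_pow_mul (k := 2) h1)

end Homogeneity

/-! ### Irreducibility -/

section Irreducibility

open Polynomial

variable {l : Fin 3 → ℂ} {F : MvPolynomial (Fin 5) ℂ}

/-- The equation `z² - f(x)` of the affine part `y = 1` of the curve `C`, as a polynomial in `z`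
over `ℂ[x]`. -/
def affineCurvePoly (l : Fin 3 → ℂ) : ℂ[X][X] := X ^ 2 - C (affineSextic l)

theorem prime_affineCurvePoly (l : Fin 3 → ℂ) : Prime (affineCurvePoly l) := by
  have hm : (affineCurvePoly l).Monic := monic_X_pow_sub_C _ two_ne_zero
  have hd : (affineCurvePoly l).natDegree = 2 := natDegree_X_pow_sub_C
  refine Irreducible.prime ?_
  rw [hm.irreducible_iff_roots_eq_zero_of_degree_le_three hd.ge (by omega)]
  refine Multiset.eq_zero_of_forall_notMem fun r hr => ?_
  -- the polynomial `f` has odd degree, so it is not a square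
  have h := isRoot_of_mem_roots hr
  rw [affineCurvePoly, IsRoot.def, eval_sub, eval_pow, eval_X, eval_C, sub_eq_zero] at h
  have := congrArg natDegree h
  rw [natDegree_pow, natDegree_affineSextic] at this
  omega

/-- The coordinate ring of the affine part `y = 1` of `C`. -/
abbrev AffineCoordRing (l : Fin 3 → ℂ) : Type := AdjoinRoot (affineCurvePoly l)

instance (l : Fin 3 → ℂ) : IsDomain (AffineCoordRing l) :=
  AdjoinRoot.isDomain_of_prime (prime_affineCurvePoly l)

/-- The coordinate ring of the family of cubics tangent to `C` at a point of its affine part; the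
fibre coordinates are `α₀`, `α₁` and `β = α₄ / 2z`. -/
abbrev TangencyRing (l : Fin 3 → ℂ) : Type := MvPolynomial (Fin 3) (AffineCoordRing l)

/-- The polynomials in `x` as functions on the family of tangent cubics. -/
def ofPoly (l : Fin 3 → ℂ) : ℂ[X] →+* TangencyRing l :=
  MvPolynomial.C.comp (AdjoinRoot.of (affineCurvePoly l))

/-- The function `z` on the family of tangent cubics. -/
def zCoord (l : Fin 3 → ℂ) : TangencyRing l := MvPolynomial.C (AdjoinRoot.root (affineCurvePoly l))

theorem zCoord_sq (l : Fin 3 → ℂ) : zCoord l ^ 2 = ofPoly l (affineSextic l) := by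
  have h : AdjoinRoot.root (affineCurvePoly l) ^ 2 =
      AdjoinRoot.of (affineCurvePoly l) (affineSextic l) := by
    have := AdjoinRoot.eval₂_root (affineCurvePoly l)
    change eval₂ _ _ (X ^ 2 - C (affineSextic l)) = 0 at this
    rwa [eval₂_sub, eval₂_pow, eval₂_X, eval₂_C, sub_eq_zero] at this
  rw [zCoord, ← map_pow, h]
  rfl

/-- The coefficients of the general cubic that is tangent to `C` at the point `(x, z)`. -/
def tangentCubic (l : Fin 3 → ℂ) : Fin 5 → TangencyRing l :=
  let x := ofPoly l X
  let a₂ := -(3 * x ^ 2 * MvPolynomial.X 0 + 2 * x * MvPolynomial.X 1 +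
    ofPoly l (derivative (affineSextic l)) * MvPolynomial.X 2)
  ![MvPolynomial.X 0, MvPolynomial.X 1, a₂,
    -(x ^ 3 * MvPolynomial.X 0 + x ^ 2 * MvPolynomial.X 1 + x * a₂ +
      2 * zCoord l ^ 2 * MvPolynomial.X 2),
    2 * zCoord l * MvPolynomial.X 2]

/-- The restriction of polynomials in `α₀, …, α₄` to the family of tangent cubics. -/
def toTangencyRing (l : Fin 3 → ℂ) : MvPolynomial (Fin 5) ℂ →+* TangencyRing l :=
  MvPolynomial.eval₂Hom ((ofPoly l).comp C) (tangentCubic l)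

theorem eval_map_ofPoly (l : Fin 3 → ℂ) (p : ℂ[X]) :
    (p.map ((ofPoly l).comp C)).eval (ofPoly l X) = ofPoly l p := by
  rw [eval_map, ← hom_eval₂, eval₂_C_X]

theorem toTangencyRing_eq_zero (hF : MvPolynomial.X 4 ^ 6 * F = (resultantPoly l).discr) :
    toTangencyRing l F = 0 := by
  set π := toTangencyRing l with hπ
  set x := ofPoly l X with hx
  have hX (i : Fin 5) : π (MvPolynomial.X i) = tangentCubic l i := by
    simp [hπ, toTangencyRing]
  have hG : (resultantPoly l).map π = sexticPoly ((affineSextic l).map ((ofPoly l).comp C))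
      (cubicPoly (tangentCubic l)) (tangentCubic l 4) := by
    rw [resultantPoly_eq, sexticPoly_map, genericCubic, cubicPoly_map, Polynomial.map_map]
    simp only [hX]
    congr 2
    ext : 1
    simp [hπ, toTangencyRing]
  have hc : (cubicPoly (tangentCubic l)).eval x = -(2 * zCoord l ^ 2 * MvPolynomial.X 2) := by
    rw [eval_cubicPoly]; simp [tangentCubic, ← hx]; ring
  have hc' : (derivative (cubicPoly (tangentCubic l))).eval x =
      -(ofPoly l (derivative (affineSextic l)) * MvPolynomial.X 2) := by
    rw [eval_derivative_cubicPoly]; simp [tangentCubic, ← hx]; ring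
  have hG0 : ((resultantPoly l).map π).eval x = 0 := by
    rw [hG, sexticPoly, eval_sub, eval_mul, eval_map_ofPoly, ← zCoord_sq, eval_pow, eval_pow, hc]
    simp [tangentCubic]; ring
  have hG1 : (derivative ((resultantPoly l).map π)).eval x = 0 := by
    rw [hG, derivative_sexticPoly, eval_sub, eval_mul, derivative_map, eval_map_ofPoly, eval_mul,
      eval_mul, hc, hc']
    simp [tangentCubic]; ring
  have hd : ((resultantPoly l).map π).natDegree ≤ 6 :=
    natDegree_map_le.trans (natDegree_resultantPoly l).le
  have h1 := resultant_eq_zero_of_common_root hd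
    ((natDegree_derivative_le _).trans (Nat.sub_le_sub_right hd 1)) (by simp) hG0 hG1
  rw [derivative_map, resultant_map_map] at h1
  have h2 := resultant_deriv (f := resultantPoly l)
    (natDegree_pos_iff_degree_pos.mp (by rw [natDegree_resultantPoly]; omega))
  rw [leadingCoeff, natDegree_resultantPoly, coeff_six_resultantPoly, ← hF] at h2
  norm_num at h2
  rw [h2, map_mul, map_mul, map_pow, map_pow, hX, hX] at h1
  have hz : zCoord l ≠ 0 := by
    rw [zCoord, Ne, MvPolynomial.C_eq_zero, AdjoinRoot.root, AdjoinRoot.mk_eq_zero]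
    intro h
    have := natDegree_le_of_dvd h X_ne_zero
    rw [natDegree_X, affineCurvePoly, natDegree_X_pow_sub_C] at this
    omega
  have h2 : (2 : TangencyRing l) ≠ 0 := by
    rw [← map_ofNat ((ofPoly l).comp C) 2]
    exact (_root_.map_ne_zero _).mpr two_ne_zero
  simpa [tangentCubic, hz, h2] using h1

/-- A polynomial vanishing on the general tangent cubic vanishes at each cubic with `α₄ ≠ 0` that
is tangent to `C`. -/
theorem eval_eq_zero_of_toTangencyRing_eq_zero (hl : Function.Injective (branchPoint l))
    (hF : MvPolynomial.X 4 ^ 6 * F = (resultantPoly l).discr) {H : MvPolynomial (Fin 5) ℂ}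
    (hH : toTangencyRing l H = 0) {a : Fin 5 → ℂ} (h4 : a 4 ≠ 0)
    (ha : MvPolynomial.eval a F = 0) : MvPolynomial.eval a H = 0 := by
  obtain ⟨x, hx, hx'⟩ := (eval_eq_zero_iff_of_ne_zero hF h4).mp ha
  rw [sexticPoly, eval_sub, eval_mul, eval_pow, eval_pow, eval_C, sub_eq_zero] at hx
  rw [derivative_sexticPoly] at hx'
  simp only [eval_sub, eval_mul, eval_pow, eval_C, eval_ofNat, sub_eq_zero] at hx'
  set z := -(cubicPoly a).eval x / a 4 with hz
  have hcz : (cubicPoly a).eval x = -(a 4 * z) := by rw [hz]; field_simp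
  have hzf : z ^ 2 = (affineSextic l).eval x := by
    rw [hz]; field_simp; linear_combination -hx
  have hz0 : z ≠ 0 := by
    intro h
    rw [h, mul_zero, neg_zero] at hcz
    rw [h, eq_comm, zero_pow two_ne_zero] at hzf
    rw [hcz] at hx'
    simp [h4, eval_derivative_affineSextic_ne_zero hl hzf] at hx'
  have hc' : 2 * z * (derivative (cubicPoly a)).eval x =
      -(a 4 * (derivative (affineSextic l)).eval x) := by
    refine mul_left_cancel₀ h4 ?_
    rw [hcz] at hx'
    linear_combination hx'
  have hroot : (affineCurvePoly l).eval₂ (evalRingHom x) z = 0 := by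
    simp [affineCurvePoly, eval₂_sub, hzf]
  let ε : TangencyRing l →+* ℂ := MvPolynomial.eval₂Hom
    (AdjoinRoot.lift (evalRingHom x) z hroot) ![a 0, a 1, a 4 / (2 * z)]
  have hεp (p : ℂ[X]) : ε (ofPoly l p) = p.eval x := by
    simp [ε, ofPoly]
  have hεz : ε (zCoord l) = z := by simp [ε, zCoord]
  have hε (i : Fin 3) : ε (MvPolynomial.X i) = ![a 0, a 1, a 4 / (2 * z)] i := by simp [ε]
  have hε2 : ε 2 = 2 := map_ofNat ε 2
  have hε3 : ε 3 = 3 := map_ofNat ε 3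
  clear_value ε z
  have hcomp : ε.comp (toTangencyRing l) = MvPolynomial.eval a := by
    rw [eval_cubicPoly] at hcz
    rw [eval_derivative_cubicPoly] at hc'
    refine MvPolynomial.ringHom_ext (fun c => ?_) fun i => ?_
    · simp [toTangencyRing, hεp]
    · have ha2 : ε (tangentCubic l 2) = a 2 := by
        simp [tangentCubic, hεp, hε, hε2, hε3]
        field_simp
        linear_combination -hc'
      have ha3 : ε (tangentCubic l 3) = a 3 := by
        have : tangentCubic l 3 = -(ofPoly l X ^ 3 * MvPolynomial.X 0 +
          ofPoly l X ^ 2 * MvPolynomial.X 1 + ofPoly l X * tangentCubic l 2 +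
            2 * zCoord l ^ 2 * MvPolynomial.X 2) := rfl
        rw [this]
        simp only [map_neg, map_add, map_mul, map_pow, hεp, hε, hεz, ha2, eval_X, hε2]
        simp
        field_simp
        linear_combination -hcz
      simp only [RingHom.comp_apply, toTangencyRing, MvPolynomial.eval_X,
        MvPolynomial.coe_eval₂Hom, MvPolynomial.eval₂_X]
      fin_cases i
      · simp [tangentCubic, hε]
      · simp [tangentCubic, hε]
      · exact ha2
      · exact ha3
      · simp [tangentCubic, hε, hεz, hε2]
        field_simp
  rw [← hcomp, RingHom.comp_apply, hH, map_zero]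

/-- On the hyperplane `α₄ = 0`, the polynomial `F` vanishes to order one along the hyperplane
`α₃ = 0` of the cubics through the Weierstrass point `(0, 0)`. -/
theorem exists_restrict_eq_X_three_mul (hl : Function.Injective (branchPoint l))
    (hF : MvPolynomial.X 4 ^ 6 * F = (resultantPoly l).discr) :
    ∃ U, restrict F = MvPolynomial.X 3 * U ∧ ¬ MvPolynomial.X 3 ∣ U := by
  refine ⟨-(64 * genericCubic.discr ^ 2 * (MvPolynomial.X 0 *
    ∏ i : Fin 4, (genericCubic.eval (MvPolynomial.C (branchPoint l i.succ))))), ?_, ?_⟩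
  · rw [restrict_eq hF, weierstrassProduct_eq, Fin.prod_univ_succ]
    have : genericCubic.eval (MvPolynomial.C (branchPoint l 0)) = MvPolynomial.X 3 := by
      simp [genericCubic, eval_cubicPoly, branchPoint]
    rw [this]
    ring
  · rintro ⟨q, hq⟩
    obtain ⟨a, h0, h3, -, hb, hd⟩ := exists_general_cubic l
    have := congrArg (MvPolynomial.eval a) hq
    rw [map_mul, MvPolynomial.eval_X, h3, zero_mul, map_neg, neg_eq_zero] at this
    simp only [map_mul, map_pow, map_prod, MvPolynomial.eval_X, eval_genericCubic, mul_eq_zero,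
      Finset.prod_eq_zero_iff, map_ofNat] at this
    rcases this with (h | h) | h | ⟨i, -, h⟩
    · norm_num at h
    · obtain ⟨x, hx, hx'⟩ :=
        (eval_discr_genericCubic_eq_zero_iff h0).mp (eq_zero_of_pow_eq_zero h)
      exact hd x hx hx'
    · exact h0 h
    · exact hb _ (hl.ne (Fin.succ_ne_zero i)) h

theorem not_X_four_dvd (hl : Function.Injective (branchPoint l))
    (hF : MvPolynomial.X 4 ^ 6 * F = (resultantPoly l).discr) : ¬ MvPolynomial.X 4 ∣ F := by
  obtain ⟨U, hU, hU3⟩ := exists_restrict_eq_X_three_mul hl hF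
  rintro ⟨q, rfl⟩
  rw [map_mul, restrict_X_four, zero_mul, eq_comm, mul_eq_zero] at hU
  exact hU3 (hU.resolve_left (MvPolynomial.X_ne_zero 3) ▸ dvd_zero _)

/-- The polynomial `F` is irreducible: its irreducible factors all vanish on the same irreducible
family of tangent cubics, and it is not a proper power. -/
theorem prime_of_mul_eq_discr (hl : Function.Injective (branchPoint l))
    (hF : MvPolynomial.X 4 ^ 6 * F = (resultantPoly l).discr) : Prime F := by
  obtain ⟨U, hU, hU3⟩ := exists_restrict_eq_X_three_mul hl hF
  have hX3 : Prime (MvPolynomial.X 3 : MvPolynomial (Fin 5) ℂ) := MvPolynomial.X_prime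
  have hX4 : Prime (MvPolynomial.X 4 : MvPolynomial (Fin 5) ℂ) := MvPolynomial.X_prime
  have hF4 : ¬ MvPolynomial.X 4 ∣ F := not_X_four_dvd hl hF
  have hF0 : F ≠ 0 := fun h => hF4 (h ▸ dvd_zero _)
  have hFker : F ∈ RingHom.ker (toTangencyRing l) := toTangencyRing_eq_zero hF
  obtain ⟨H, hHker, hH⟩ := (RingHom.ker_isPrime (toTangencyRing l)).exists_mem_prime_of_ne_bot
    ((Submodule.ne_bot_iff _).mpr ⟨F, hFker, hF0⟩)
  -- by the Nullstellensatz, `F` divides a power of `α₄ H`, hence a power of `H`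
  have hrad : H * MvPolynomial.X 4 ∈ (Ideal.span {F}).radical := by
    rw [← MvPolynomial.vanishingIdeal_zeroLocus_eq_radical (K := ℂ)]
    intro a ha
    have ha' : MvPolynomial.eval a F = 0 := by
      have := ha F (Ideal.mem_span_singleton_self F)
      simpa [MvPolynomial.coe_aeval_eq_eval] using this
    rw [map_mul, MvPolynomial.aeval_X]
    by_cases h4 : a 4 = 0
    · rw [h4, mul_zero]
    · have := eval_eq_zero_of_toTangencyRing_eq_zero hl hF hHker h4 ha'
      rw [show MvPolynomial.aeval a H = 0 by simpa [MvPolynomial.coe_aeval_eq_eval] using this,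
        zero_mul]
  obtain ⟨n, hn⟩ := hrad
  rw [Ideal.mem_span_singleton, mul_pow] at hn
  have hrel : IsRelPrime F (MvPolynomial.X 4 ^ n) :=
    ((hX4.irreducible.isRelPrime_iff_not_dvd.mpr hF4).pow_left).symm
  obtain ⟨k, -, u, hk⟩ := (dvd_prime_pow hH n).mp (hrel.dvd_of_dvd_mul_right hn)
  -- comparison with the order of `F` along `α₃ = α₄ = 0` shows that `F` is not a proper power
  have hu : IsUnit (restrict (u : MvPolynomial (Fin 5) ℂ)) := u.isUnit.map restrict
  have hres : MvPolynomial.X 3 * U * restrict (u : MvPolynomial (Fin 5) ℂ) = restrict H ^ k := by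
    rw [← hU, ← map_mul, hk, map_pow]
  have h3H : MvPolynomial.X 3 ∣ restrict H := by
    refine hX3.dvd_of_dvd_pow (n := k) ?_
    rw [← hres, mul_assoc]
    exact dvd_mul_right _ _
  obtain ⟨V, hV⟩ := h3H
  have hk1 : k = 1 := by
    rcases k with _ | _ | k
    · rw [pow_zero, mul_assoc] at hres
      exact absurd (IsUnit.of_mul_eq_one _ hres) hX3.not_isUnit
    · rfl
    · exfalso
      refine hU3 (hu.dvd_mul_right.mp ⟨V * restrict H ^ k * V, ?_⟩)
      refine mul_left_cancel₀ hX3.ne_zero ?_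
      rw [← mul_assoc, hres, hV]
      ring
  rw [hk1, pow_one] at hk
  exact (Associated.prime_iff ⟨u, hk⟩).mpr hH

/-- The ideal of the locus `F = 0`, with the origin removed. -/
theorem vanishingIdeal_eq_span (hl : Function.Injective (branchPoint l))
    (hF : MvPolynomial.X 4 ^ 6 * F = (resultantPoly l).discr) {S : Set (Fin 5 → ℂ)}
    (hS : ∀ a, a ≠ 0 → (a ∈ S ↔ MvPolynomial.eval a F = 0)) (hS0 : 0 ∉ S) :
    MvPolynomial.vanishingIdeal ℂ S = Ideal.span {F} := by
  have hprime := prime_of_mul_eq_discr hl hF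
  have : (Ideal.span {F}).IsPrime := (Ideal.span_singleton_prime hprime.ne_zero).mpr hprime
  refine le_antisymm (fun p hp => ?_) ?_
  · have h4 : p * MvPolynomial.X 4 ∈ Ideal.span {F} := by
      rw [← this.radical, ← MvPolynomial.vanishingIdeal_zeroLocus_eq_radical (K := ℂ)]
      intro a ha
      rw [map_mul, MvPolynomial.aeval_X]
      by_cases h4 : a 4 = 0
      · rw [h4, mul_zero]
      · have ha0 : a ≠ 0 := fun h => h4 (congrFun h 4)
        rw [hp a ((hS a ha0).mpr ?_), zero_mul]
        have := ha F (Ideal.mem_span_singleton_self F)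
        simpa [MvPolynomial.coe_aeval_eq_eval] using this
    refine (this.mem_or_mem h4).resolve_right fun h => ?_
    rw [Ideal.mem_span_singleton] at h
    exact not_X_four_dvd hl hF
      (hprime.irreducible.dvd_symm MvPolynomial.X_prime.irreducible h)
  · rw [Ideal.span_singleton_le_iff_mem]
    intro a ha
    have ha0 : a ≠ 0 := fun h => hS0 (h ▸ ha)
    simpa [MvPolynomial.coe_aeval_eq_eval] using (hS a ha0).mp ha

end Irreducibility

/-! ### Local intersection rings -/

section Local

open Polynomial

variable (f c : ℂ[X]) (s : ℂ) (p : ℂ × ℂ)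

/-- The equation `c(x) + s z` of a cubic in an affine chart of `ℙ(1, 1, 3)`. -/
def chartCubic : ℂ[X][X] := C c + C (C s) * X

/-- The ideal of the intersection of the plane curves `z² = f(x)` and `c(x) + s z = 0` in the local
ring of the plane at `p`. -/
def localIdeal : Ideal (PlaneLocalRing p) :=
  Ideal.span {algebraMap ℂ[X][X] (PlaneLocalRing p) (X ^ 2 - C f),
    algebraMap ℂ[X][X] (PlaneLocalRing p) (chartCubic c s)}

variable {f c s p}

theorem mem_localIdeal_left :
    algebraMap ℂ[X][X] (PlaneLocalRing p) (X ^ 2 - C f) ∈ localIdeal f c s p :=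
  Ideal.subset_span (Set.mem_insert _ _)

theorem mem_localIdeal_right :
    algebraMap ℂ[X][X] (PlaneLocalRing p) (chartCubic c s) ∈ localIdeal f c s p :=
  Ideal.subset_span (Set.mem_insert_of_mem _ rfl)

theorem isUnit_algebraMap_planeLocalRing {g : ℂ[X][X]} (hg : g.evalEval p.1 p.2 ≠ 0) :
    IsUnit (algebraMap ℂ[X][X] (PlaneLocalRing p) g) :=
  IsLocalization.map_units (M := (RingHom.ker (evalEvalRingHom p.1 p.2)).primeCompl) _ ⟨g, hg⟩

theorem localIdeal_eq_top (h : p.2 ^ 2 ≠ f.eval p.1 ∨ c.eval p.1 + s * p.2 ≠ 0) :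
    localIdeal f c s p = ⊤ := by
  rcases h with h | h
  · refine Ideal.eq_top_of_isUnit_mem _ mem_localIdeal_left (isUnit_algebraMap_planeLocalRing ?_)
    simpa [sub_eq_zero, evalEval_C] using h
  · refine Ideal.eq_top_of_isUnit_mem _ mem_localIdeal_right (isUnit_algebraMap_planeLocalRing ?_)
    simpa [chartCubic, evalEval_C] using h

theorem exists_eq_C_eval_add (q : ℂ[X]) (x : ℂ) :
    ∃ r : ℂ[X], q = C (q.eval x) + (X - C x) * r ∧ r.eval x = (derivative q).eval x := by
  obtain ⟨r, hr⟩ := X_sub_C_dvd_sub_C_eval (p := q) (a := x)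
  have h : q = C (q.eval x) + (X - C x) * r := by rw [← hr]; ring
  refine ⟨r, h, ?_⟩
  rw [h]
  simp [derivative_mul]

theorem maximalIdeal_planeLocalRing_le {I : Ideal (PlaneLocalRing p)}
    (hx : algebraMap ℂ[X][X] (PlaneLocalRing p) (C (X - C p.1)) ∈ I)
    (hz : algebraMap ℂ[X][X] (PlaneLocalRing p) (X - C (C p.2)) ∈ I) :
    IsLocalRing.maximalIdeal (PlaneLocalRing p) ≤ I := by
  rw [← Localization.AtPrime.map_eq_maximalIdeal, Ideal.map_le_iff_le_comap]
  intro g hg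
  have hg0 : (g.eval (C p.2)).eval p.1 = 0 := hg
  obtain ⟨r, hr⟩ := X_sub_C_dvd_sub_C_eval (p := g) (a := C p.2)
  obtain ⟨t, ht⟩ := dvd_iff_isRoot.mpr hg0
  have : g = (X - C (C p.2)) * r + C (X - C p.1) * C t := by
    rw [← hr, ← C_mul, ← ht]; ring
  rw [Ideal.mem_comap, this, map_add, map_mul, map_mul]
  exact I.add_mem (I.mul_mem_right _ hz) (I.mul_mem_right _ hx)

/-- The two curves meet transversally at `p`. -/
theorem localIdeal_eq_maximalIdeal (h1 : p.2 ^ 2 = f.eval p.1) (h2 : c.eval p.1 + s * p.2 = 0)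
    (h3 : s * (derivative f).eval p.1 + 2 * p.2 * (derivative c).eval p.1 ≠ 0) :
    localIdeal f c s p = IsLocalRing.maximalIdeal (PlaneLocalRing p) := by
  obtain ⟨q, hq, hq'⟩ := exists_eq_C_eval_add f p.1
  obtain ⟨r, hr, hr'⟩ := exists_eq_C_eval_add c p.1
  set g : ℂ[X][X] := X ^ 2 - C f with hg
  set h : ℂ[X][X] := chartCubic c s with hh
  -- `δ` is the Jacobian determinant of the two equations at `p`, up to terms vanishing at `p`;
  -- by Cramer's rule, `δ` times either local parameter lies in the ideal
  set δ : ℂ[X][X] := C (C s) * C q + (X + C (C p.2)) * C r with hδ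
  have hC1 : (C (C (f.eval p.1)) : ℂ[X][X]) = C (C p.2) ^ 2 := by rw [← h1]; simp
  have hC2 : (C (C (c.eval p.1)) : ℂ[X][X]) = -(C (C s) * C (C p.2)) := by
    rw [eq_neg_of_add_eq_zero_left h2]; simp
  have hg' : g = (X - C (C p.2)) * (X + C (C p.2)) - C (X - C p.1) * C q := by
    rw [hg]
    conv_lhs => rw [hq]
    rw [C_add, C_mul, hC1]
    ring
  have hh' : h = C (X - C p.1) * C r + C (C s) * (X - C (C p.2)) := by
    rw [hh, chartCubic]
    conv_lhs => rw [hr]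
    rw [C_add, C_mul, hC2]
    ring
  have hu : IsUnit (algebraMap ℂ[X][X] (PlaneLocalRing p) δ) := by
    refine isUnit_algebraMap_planeLocalRing ?_
    rw [hδ]
    simp only [evalEval_add, evalEval_mul, evalEval_C, eval_C, evalEval_X, hq', hr']
    convert h3 using 1
    ring
  have key (w : ℂ[X][X]) (hw : ∃ a b, w * δ = a * g + b * h) :
      algebraMap ℂ[X][X] (PlaneLocalRing p) w ∈ localIdeal f c s p := by
    obtain ⟨a, b, hab⟩ := hw
    rw [← Ideal.mul_unit_mem_iff_mem _ hu, ← map_mul, hab, map_add, map_mul, map_mul]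
    exact Ideal.add_mem _ (Ideal.mul_mem_left _ _ mem_localIdeal_left)
      (Ideal.mul_mem_left _ _ mem_localIdeal_right)
  refine le_antisymm (IsLocalRing.le_maximalIdeal ?_) (maximalIdeal_planeLocalRing_le
    (key _ ⟨-C (C s), X + C (C p.2), ?_⟩) (key _ ⟨C r, C q, ?_⟩))
  · have hmem (w : ℂ[X][X]) (hw : w.evalEval p.1 p.2 = 0) :
        algebraMap ℂ[X][X] (PlaneLocalRing p) w ∈ IsLocalRing.maximalIdeal (PlaneLocalRing p) := by
      rw [IsLocalization.AtPrime.to_map_mem_maximal_iff _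
        (RingHom.ker (evalEvalRingHom p.1 p.2))]
      exact hw
    have : localIdeal f c s p ≤ IsLocalRing.maximalIdeal (PlaneLocalRing p) := by
      rw [localIdeal, Ideal.span_le]
      rintro _ (rfl | rfl)
      · exact hmem _ (by simp [h1, evalEval_C])
      · exact hmem _ (by simpa [chartCubic, evalEval_C] using h2)
    exact fun htop => (IsLocalRing.maximalIdeal.isMaximal _).ne_top (top_le_iff.mp (htop ▸ this))
  · rw [hg', hh', hδ]; ring
  · rw [hg', hh', hδ]; ring

/-- The tangent vector `(2 z₀, f'(x₀))` of the curve `z² = f(x)` at `p = (x₀, z₀)`, as a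
homomorphism from the local ring of the plane to the dual numbers. -/
theorem exists_tangent_hom (f : ℂ[X]) (p : ℂ × ℂ) :
    ∃ ψ : PlaneLocalRing p →+* DualNumber ℂ,
      (∀ q : ℂ[X], ψ (algebraMap ℂ[X][X] _ (C q)) =
        algebraMap ℂ _ (q.eval p.1) +
          algebraMap ℂ _ (2 * p.2 * (derivative q).eval p.1) * DualNumber.eps) ∧
      ψ (algebraMap ℂ[X][X] _ X) =
        algebraMap ℂ _ p.2 + algebraMap ℂ _ ((derivative f).eval p.1) * DualNumber.eps := by
  let φ : ℂ[X][X] →+* DualNumber ℂ := eval₂RingHom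
    (aeval (algebraMap ℂ (DualNumber ℂ) p.1 +
      algebraMap ℂ (DualNumber ℂ) (2 * p.2) * DualNumber.eps) : ℂ[X] →ₐ[ℂ] DualNumber ℂ)
    (algebraMap ℂ _ p.2 + algebraMap ℂ _ ((derivative f).eval p.1) * DualNumber.eps)
  have hC (q : ℂ[X]) : φ (C q) = algebraMap ℂ _ (q.eval p.1) +
      algebraMap ℂ _ (2 * p.2 * (derivative q).eval p.1) * DualNumber.eps := by
    have h0 : (algebraMap ℂ (DualNumber ℂ) (2 * p.2) * DualNumber.eps) ^ 2 = 0 := by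
      rw [mul_pow, DualNumber.eps_pow_two, mul_zero]
    have : φ (C q) = aeval (algebraMap ℂ (DualNumber ℂ) p.1 +
      algebraMap ℂ (DualNumber ℂ) (2 * p.2) * DualNumber.eps) q := by simp [φ]
    rw [this, aeval_add_of_sq_eq_zero _ _ _ h0, aeval_algebraMap_apply, aeval_algebraMap_apply,
      map_mul _ (2 * p.2)]
    simp only [coe_aeval_eq_eval]
    ring
  have hX : φ X = algebraMap ℂ _ p.2 +
      algebraMap ℂ _ ((derivative f).eval p.1) * DualNumber.eps := by simp [φ]
  have hinl (w : ℂ) : (algebraMap ℂ (DualNumber ℂ) w).fst = w := rfl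
  have hfst : (TrivSqZeroExt.fstHom ℂ ℂ ℂ : DualNumber ℂ →+* ℂ).comp φ =
      evalEvalRingHom p.1 p.2 := by
    refine Polynomial.ringHom_ext (fun q => ?_) ?_
    · rw [RingHom.comp_apply, hC]
      simp [hinl]
    · rw [RingHom.comp_apply, hX]
      simp [hinl]
  have hunit (y : (RingHom.ker (evalEvalRingHom p.1 p.2)).primeCompl) : IsUnit (φ y) := by
    rw [TrivSqZeroExt.isUnit_iff_isUnit_fst, isUnit_iff_ne_zero]
    have := DFunLike.congr_fun hfst (y : ℂ[X][X])
    intro h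
    exact y.2 (this.symm.trans h)
  refine ⟨IsLocalization.lift hunit, fun q => ?_, ?_⟩
  · rw [IsLocalization.lift_eq, hC]
  · rw [IsLocalization.lift_eq, hX]

/-- If the two curves are tangent at a smooth point of `z² = f(x)`, then the local ring of their
intersection has nilpotents: it maps to the dual numbers over the tangent vector, and the images of
the local parameters are nilpotent as the intersection is finite. -/
theorem not_isReduced_of_tangent (h1 : p.2 ^ 2 = f.eval p.1) (h2 : c.eval p.1 + s * p.2 = 0)
    (h3 : s * (derivative f).eval p.1 + 2 * p.2 * (derivative c).eval p.1 = 0)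
    (h4 : p.2 ≠ 0 ∨ (derivative f).eval p.1 ≠ 0) (h5 : sexticPoly f c s ≠ 0) :
    ¬ IsReduced (PlaneLocalRing p ⧸ localIdeal f c s p) := by
  intro hred
  obtain ⟨ψ, hψC, hψX⟩ := exists_tangent_hom f p
  have heps (w : ℂ) (hw : w ≠ 0) : algebraMap ℂ (DualNumber ℂ) w * DualNumber.eps ≠ 0 := by
    intro h
    have h' : (algebraMap ℂ (DualNumber ℂ) w).fst = 0 := by
      simpa using congrArg TrivSqZeroExt.snd h
    exact hw h'
  have hker : localIdeal f c s p ≤ RingHom.ker ψ := by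
    rw [localIdeal, Ideal.span_le]
    rintro _ (rfl | rfl)
    · rw [SetLike.mem_coe, RingHom.mem_ker, map_sub, map_sub, map_pow, map_pow, hψX, hψC, ← h1]
      simp only [map_pow, map_mul, map_ofNat]
      linear_combination (algebraMap ℂ (DualNumber ℂ) ((derivative f).eval p.1)) ^ 2 *
        DualNumber.eps_pow_two (R := ℂ)
    · rw [SetLike.mem_coe, RingHom.mem_ker, chartCubic, map_add, map_add, map_mul, map_mul, hψX,
        hψC, hψC]
      have h2' := congrArg (algebraMap ℂ (DualNumber ℂ)) h2
      have h3' := congrArg (algebraMap ℂ (DualNumber ℂ)) h3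
      simp only [map_add, map_mul, map_ofNat, map_zero, eval_C, derivative_C, eval_zero]
        at h2' h3' ⊢
      linear_combination h2' + DualNumber.eps (R := ℂ) * h3'
  let θ : ℂ[X][X] →+* PlaneLocalRing p ⧸ localIdeal f c s p :=
    (Ideal.Quotient.mk _).comp (algebraMap _ _)
  have hθ (w : ℂ[X][X]) (hw : θ w = 0) : ψ (algebraMap _ _ w) = 0 :=
    hker (Ideal.Quotient.eq_zero_iff_mem.mp hw)
  have hθg : θ X ^ 2 = θ (C f) := by
    rw [← map_pow, ← sub_eq_zero, ← map_sub]
    exact Ideal.Quotient.eq_zero_iff_mem.mpr mem_localIdeal_left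
  have hθh : θ (C c) = -(θ (C (C s)) * θ X) := by
    rw [← map_mul, eq_neg_iff_add_eq_zero, ← map_add]
    exact Ideal.Quotient.eq_zero_iff_mem.mpr mem_localIdeal_right
  -- the image of `x - x₀` is nilpotent, as `s² f - c²` lies in the ideal, so it is zero
  have hx : θ (C (X - C p.1)) = 0 := by
    obtain ⟨q, hq, hq'⟩ := exists_eq_pow_rootMultiplicity_mul_and_not_dvd _ h5 p.1
    have hG : θ (C (sexticPoly f c s)) = 0 := by
      simp only [sexticPoly, map_sub, map_mul, map_pow, hθh, ← hθg]
      ring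
    have hu : IsUnit (θ (C q)) := by
      refine (isUnit_algebraMap_planeLocalRing (g := C q) ?_).map (Ideal.Quotient.mk _)
      rw [dvd_iff_isRoot, IsRoot.def] at hq'
      simpa [evalEval_C] using hq'
    rw [hq, C_mul, C_pow, map_mul, map_pow, hu.mul_left_eq_zero] at hG
    exact eq_zero_of_pow_eq_zero hG
  have hz0 : p.2 = 0 := by
    by_contra hz
    have := hθ _ hx
    rw [hψC] at this
    refine heps (2 * p.2) (mul_ne_zero two_ne_zero hz) ?_
    simpa using this
  -- now `f(x₀) = 0`, so `z² = f(x)` is zero as well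
  have hX : θ X = 0 := by
    refine eq_zero_of_pow_eq_zero (n := 2) ?_
    rw [hz0, eq_comm, zero_pow two_ne_zero] at h1
    obtain ⟨t, ht⟩ := dvd_iff_isRoot.mpr h1
    have ht' : θ (C f) = θ (C ((X - C p.1) * t)) := congrArg (fun w => θ (C w)) ht
    rw [hθg, ht', C_mul, map_mul, hx, zero_mul]
  have := hθ _ hX
  rw [hψX, hz0, map_zero, zero_add] at this
  exact heps _ (h4.resolve_left fun h => h hz0) this

theorem isReduced_and_length_quotient_maximalIdeal {R : Type*} [CommRing R] {I : Ideal R}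
    (hI : I.IsMaximal) : IsReduced (R ⧸ I) ∧ Module.length (R ⧸ I) (R ⧸ I) = 1 := by
  let := Ideal.Quotient.field I
  exact ⟨inferInstance, Module.length_eq_one _ _⟩

/-- A commutative ring of length at most one over itself is reduced. -/
theorem isReduced_of_length_le_one {R : Type*} [CommRing R] (h : Module.length R R ≤ 1) :
    IsReduced R := by
  rcases eq_or_ne (Module.length R R) 0 with h0 | h0
  · have := Module.length_eq_zero_iff.mp h0
    infer_instance
  · have h1 := Module.length_eq_one_iff.mp (le_antisymm h (Order.one_le_iff_ne_zero.mpr h0))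
    have hu := (isSimpleModule_self_iff_isUnit.mp h1).2
    have := (isSimpleModule_self_iff_isUnit.mp h1).1
    refine ⟨fun x ⟨n, hn⟩ => by_contra fun hx => ((hu x hx).pow n).ne_zero hn⟩

end Local

/-! ### The points of the curve and of its intersection with a cubic -/

section Points

open Polynomial

variable {l : Fin 3 → ℂ}

/-- The polynomial `f(1, y)`, so that `z² = f(1, y)` is the equation of `C` in the chart `x = 1`. -/
def infinitySextic (l : Fin 3 → ℂ) : ℂ[X] := X * (1 - X) * ∏ i, (1 - C (l i) * X)

theorem eval_infinitySextic (l : Fin 3 → ℂ) : (infinitySextic l).eval 0 = 0 := by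
  simp [infinitySextic]

theorem eval_derivative_infinitySextic (l : Fin 3 → ℂ) :
    (derivative (infinitySextic l)).eval 0 = 1 := by
  simp [infinitySextic, derivative_mul, eval_prod]

theorem intersectionIdeal_of_ne_zero (a : Fin 5 → ℂ) {v : Fin 3 → ℂ} (hv : v 1 ≠ 0) :
    intersectionIdeal l a v =
      localIdeal (affineSextic l) (cubicPoly a) (a 4) (chartCoord v) := by
  have h1 : dehomogenize v (curveForm l) = X ^ 2 - C (affineSextic l) := by
    rw [dehomogenize, if_pos hv, curveForm, affineSextic, sexticForm]
    simp [Fin.prod_univ_succ]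
  have h2 : dehomogenize v (cubicForm a) = chartCubic (cubicPoly a) (a 4) := by
    rw [dehomogenize, if_pos hv, cubicForm, chartCubic, cubicPoly]
    simp
  rw [intersectionIdeal, localIdeal, h1, h2]

theorem intersectionIdeal_of_eq_zero (a : Fin 5 → ℂ) {v : Fin 3 → ℂ} (hv : v 1 = 0) :
    intersectionIdeal l a v =
      localIdeal (infinitySextic l) (cubicPoly ![a 3, a 2, a 1, a 0, a 4]) (a 4)
        (chartCoord v) := by
  have hv' : ¬ v 1 ≠ 0 := not_not.mpr hv
  have h1 : dehomogenize v (curveForm l) = X ^ 2 - C (infinitySextic l) := by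
    rw [dehomogenize, if_neg hv', curveForm, infinitySextic, sexticForm]
    simp [Fin.prod_univ_succ]
  have h2 : dehomogenize v (cubicForm a) =
      chartCubic (cubicPoly ![a 3, a 2, a 1, a 0, a 4]) (a 4) := by
    rw [dehomogenize, if_neg hv', cubicForm, chartCubic, cubicPoly]
    simp
    ring
  rw [intersectionIdeal, localIdeal, h1, h2]

theorem eval_curveForm (l : Fin 3 → ℂ) (v : Fin 3 → ℂ) :
    MvPolynomial.eval v (curveForm l) =
      v 2 ^ 2 - v 0 * v 1 * (v 0 - v 1) * ∏ i, (v 0 - l i * v 1) := by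
  simp [curveForm, sexticForm]

theorem eval_affineSextic (l : Fin 3 → ℂ) (x : ℂ) :
    (affineSextic l).eval x = x * (x - 1) * ∏ i, (x - l i) := by
  simp [affineSextic_eq_prod, Fin.prod_univ_succ, branchPoint]
  ring

theorem Curve.rep_spec (p : Curve l) : p.rep ≠ 0 ∧ p.rep 2 ^ 2 =
    p.rep 0 * p.rep 1 * (p.rep 0 - p.rep 1) * ∏ i, (p.rep 0 - l i * p.rep 1) := by
  have h := (Quotient.out (s := weightedSetoid l) p).2
  rw [eval_curveForm, sub_eq_zero] at h
  exact h

theorem Curve.eq_of_smul {p q : Curve l} {t : ℂ} (ht : t ≠ 0) (h0 : q.rep 0 = t * p.rep 0)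
    (h1 : q.rep 1 = t * p.rep 1) (h2 : q.rep 2 = t ^ 3 * p.rep 2) : p = q := by
  rw [← Quotient.out_eq (s := weightedSetoid l) p, ← Quotient.out_eq (s := weightedSetoid l) q]
  exact Quotient.sound ⟨t, ht, h0, h1, h2⟩

theorem Curve.exists_rep_mk (v : CurveCone l) : ∃ t : ℂ, t ≠ 0 ∧
    Curve.rep (Quotient.mk (weightedSetoid l) v) 0 = t * v.1 0 ∧
    Curve.rep (Quotient.mk (weightedSetoid l) v) 1 = t * v.1 1 ∧
    Curve.rep (Quotient.mk (weightedSetoid l) v) 2 = t ^ 3 * v.1 2 :=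
  (weightedSetoid l).symm (Quotient.mk_out (s := weightedSetoid l) v)

/-- A point `(x, z)` of the affine part `y = 1` of the curve is mapped to `some (x, z)`, and the
point `[1 : 0 : 0]` is mapped to `none`. -/
def Curve.coord (p : Curve l) : Option (ℂ × ℂ) :=
  open Classical in if p.rep 1 ≠ 0 then some (chartCoord p.rep) else none

theorem Curve.rep_zero_ne_zero {p : Curve l} (h : p.rep 1 = 0) : p.rep 0 ≠ 0 ∧ p.rep 2 = 0 := by
  obtain ⟨h0, h1⟩ := p.rep_spec
  have h2 : p.rep 2 = 0 := by
    rw [h] at h1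
    simpa using h1
  refine ⟨fun h3 => h0 (funext fun i => ?_), h2⟩
  fin_cases i <;> assumption

theorem Curve.coord_eq_none_iff {p : Curve l} :
    p.coord = none ↔ p.rep 1 = 0 ∧ chartCoord p.rep = (0, 0) := by
  by_cases h : p.rep 1 = 0
  · have := rep_zero_ne_zero h
    simp [coord, chartCoord, h, this.2]
  · simp [coord, h]

theorem Curve.coord_eq_some_iff {p : Curve l} {w : ℂ × ℂ} :
    p.coord = some w ↔ p.rep 1 ≠ 0 ∧ chartCoord p.rep = w := by
  by_cases h : p.rep 1 = 0 <;> simp [coord, h]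

theorem Curve.sq_eq_of_coord_eq_some {p : Curve l} {w : ℂ × ℂ} (h : p.coord = some w) :
    w.2 ^ 2 = (affineSextic l).eval w.1 := by
  obtain ⟨h1, rfl⟩ := coord_eq_some_iff.mp h
  have h2 := p.rep_spec.2
  rw [chartCoord, if_pos h1, eval_affineSextic]
  rw [Fin.prod_univ_three] at *
  field_simp
  linear_combination h2

theorem Curve.coord_injective : Function.Injective (Curve.coord (l := l)) := by
  intro p q h
  rcases hp : p.coord with _ | w
  · rw [hp] at h
    obtain ⟨hp1, -⟩ := coord_eq_none_iff.mp hp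
    obtain ⟨hq1, -⟩ := coord_eq_none_iff.mp h.symm
    obtain ⟨hp0, hp2⟩ := rep_zero_ne_zero hp1
    obtain ⟨hq0, hq2⟩ := rep_zero_ne_zero hq1
    refine eq_of_smul (t := q.rep 0 / p.rep 0) (div_ne_zero hq0 hp0) ?_ ?_ ?_
    · field_simp
    · simp [hp1, hq1]
    · simp [hp2, hq2]
  · rw [hp] at h
    obtain ⟨hp1, hp2⟩ := coord_eq_some_iff.mp hp
    obtain ⟨hq1, hq2⟩ := coord_eq_some_iff.mp h.symm
    rw [← hq2, chartCoord, chartCoord, if_pos hp1, if_pos hq1, Prod.mk.injEq] at hp2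
    refine eq_of_smul (t := q.rep 1 / p.rep 1) (div_ne_zero hq1 hp1) ?_ ?_ ?_
    · have := hp2.1
      field_simp at this ⊢
      linear_combination -this
    · field_simp
    · have := hp2.2
      field_simp at this ⊢
      linear_combination -this

theorem Curve.exists_coord_eq_some {w : ℂ × ℂ} (h : w.2 ^ 2 = (affineSextic l).eval w.1) :
    ∃ p : Curve l, p.coord = some w := by
  have hv : MvPolynomial.eval ![w.1, 1, w.2] (curveForm l) = 0 := by
    rw [eval_curveForm]
    rw [eval_affineSextic] at h
    simp [h]
  let v : CurveCone l := ⟨![w.1, 1, w.2], fun h => by simpa using congrFun h 1, hv⟩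
  obtain ⟨t, ht, h0, h1, h2⟩ := exists_rep_mk v
  have hv0 : v.1 0 = w.1 := rfl
  have hv1 : v.1 1 = 1 := rfl
  have hv2 : v.1 2 = w.2 := rfl
  rw [hv0] at h0
  rw [hv1, mul_one] at h1
  rw [hv2] at h2
  refine ⟨Quotient.mk (weightedSetoid l) v, coord_eq_some_iff.mpr ⟨?_, ?_⟩⟩
  · rwa [h1]
  · rw [chartCoord, if_pos (by rwa [h1]), h0, h1, h2, mul_div_cancel_left₀ _ ht,
      mul_div_cancel_left₀ _ (pow_ne_zero 3 ht)]

theorem Curve.exists_coord_eq_none (l : Fin 3 → ℂ) : ∃ p : Curve l, p.coord = none := by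
  have hv : MvPolynomial.eval ![1, 0, 0] (curveForm l) = 0 := by
    rw [eval_curveForm]
    simp
  let v : CurveCone l := ⟨![1, 0, 0], fun h => by simpa using congrFun h 0, hv⟩
  obtain ⟨t, ht, h0, h1, h2⟩ := exists_rep_mk v
  have hv1 : v.1 1 = 0 := rfl
  have hv2 : v.1 2 = 0 := rfl
  rw [hv1, mul_zero] at h1
  rw [hv2, mul_zero] at h2
  refine ⟨Quotient.mk (weightedSetoid l) v, coord_eq_none_iff.mpr ⟨?_, ?_⟩⟩
  · exact h1
  · rw [chartCoord, if_neg (not_not.mpr h1), h1, h2, zero_div, zero_div]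

/-- The intersection points of `C` with the cubic with coefficients `a`, in the coordinates of
`Curve.coord`. -/
def intersectionSet (l : Fin 3 → ℂ) (a : Fin 5 → ℂ) : Set (Option (ℂ × ℂ)) :=
  {o | (o = none ∧ a 0 = 0) ∨ ∃ w : ℂ × ℂ, o = some w ∧ w.2 ^ 2 = (affineSextic l).eval w.1 ∧
    (cubicPoly a).eval w.1 + a 4 * w.2 = 0}

theorem intersectionSet_subset_range (l : Fin 3 → ℂ) (a : Fin 5 → ℂ) :
    intersectionSet l a ⊆ Set.range (Curve.coord (l := l)) := by
  rintro o (⟨rfl, -⟩ | ⟨w, rfl, h, -⟩)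
  · exact Curve.exists_coord_eq_none l
  · exact Curve.exists_coord_eq_some h

theorem sexticPoly_ne_zero {f c : ℂ[X]} {s x : ℂ} (hx : f.eval x = 0)
    (hx' : (derivative f).eval x ≠ 0) (h : s ≠ 0 ∨ c ≠ 0) : sexticPoly f c s ≠ 0 := by
  intro h0
  have h1 := congrArg (eval x) h0
  have h2 := congrArg (fun q => (derivative q).eval x) h0
  rw [derivative_sexticPoly] at h2
  simp only [sexticPoly, eval_sub, eval_mul, eval_pow, eval_C, hx, mul_zero, zero_sub, eval_zero,
    neg_eq_zero, derivative_zero] at h1 h2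
  rw [eq_zero_of_pow_eq_zero h1] at h2
  have hs : s = 0 := by simpa [hx'] using h2
  refine h.resolve_left (not_not.mpr hs) ?_
  simpa [sexticPoly, hs] using h0

variable {F : MvPolynomial (Fin 5) ℂ} {a : Fin 5 → ℂ} {p : Curve l}

/-- If `F` does not vanish at `a`, then the cubic is transverse to `C` everywhere. -/
theorem isMaximal_intersectionIdeal
    (hF : MvPolynomial.X 4 ^ 6 * F = (resultantPoly l).discr) (ha : MvPolynomial.eval a F ≠ 0)
    (hp : p.coord ∈ intersectionSet l a) : (intersectionIdeal l a p.rep).IsMaximal := by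
  rcases hp with ⟨hp, h0⟩ | ⟨w, hp, hw, hw'⟩
  · obtain ⟨h1, h2⟩ := Curve.coord_eq_none_iff.mp hp
    have h4 : a 4 ≠ 0 := fun h4 => ha ((eval_eq_zero_iff_of_eq_zero hF h4).mpr (Or.inl h0))
    rw [intersectionIdeal_of_eq_zero a h1, localIdeal_eq_maximalIdeal]
    · infer_instance
    · simp [h2, eval_infinitySextic]
    · simp [h2, eval_cubicPoly, h0]
    · simpa [h2, eval_derivative_infinitySextic] using h4
  · obtain ⟨h1, h2⟩ := Curve.coord_eq_some_iff.mp hp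
    rw [intersectionIdeal_of_ne_zero a h1, h2, localIdeal_eq_maximalIdeal hw hw']
    · infer_instance
    · intro h
      by_cases h4 : a 4 = 0
      · rw [Ne, eval_eq_zero_iff_of_eq_zero hF h4] at ha
        push Not at ha
        obtain ⟨-, hb, hd⟩ := ha
        rw [h4, zero_mul, add_zero] at hw'
        have hz : w.2 ≠ 0 := by
          intro hz
          rw [hz, eq_comm, zero_pow two_ne_zero] at hw
          obtain ⟨i, hi⟩ := (eval_affineSextic_eq_zero_iff l _).mp hw
          exact hb i (hi ▸ hw')
        exact hd _ hw' (by simpa [h4, hz] using h)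
      · refine ha ((eval_eq_zero_iff_of_ne_zero hF h4).mpr ⟨w.1, ?_, ?_⟩)
        · rw [sexticPoly]
          simp only [eval_sub, eval_mul, eval_pow, eval_C, ← hw, eq_neg_of_add_eq_zero_left hw']
          ring
        · rw [derivative_sexticPoly]
          simp only [eval_sub, eval_mul, eval_pow, eval_C, eval_ofNat,
            eq_neg_of_add_eq_zero_left hw']
          linear_combination a 4 * h

theorem intersectionIdeal_eq_top (hp : p.coord ∉ intersectionSet l a) :
    intersectionIdeal l a p.rep = ⊤ := by
  rcases hc : p.coord with _ | w
  · obtain ⟨h1, h2⟩ := Curve.coord_eq_none_iff.mp hc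
    have h0 : a 0 ≠ 0 := fun h0 => hp (Or.inl ⟨hc, h0⟩)
    rw [intersectionIdeal_of_eq_zero a h1, localIdeal_eq_top]
    right
    simpa [h2, eval_cubicPoly] using h0
  · obtain ⟨h1, h2⟩ := Curve.coord_eq_some_iff.mp hc
    rw [intersectionIdeal_of_ne_zero a h1, localIdeal_eq_top]
    right
    intro h
    rw [h2] at h
    exact hp (Or.inr ⟨w, hc, Curve.sq_eq_of_coord_eq_some hc, h⟩)

theorem not_isReduced_of_coord_eq_some (hl : Function.Injective (branchPoint l)) (ha : a ≠ 0)
    {w : ℂ × ℂ} (hp : p.coord = some w) (h : (cubicPoly a).eval w.1 + a 4 * w.2 = 0)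
    (h' : a 4 * (derivative (affineSextic l)).eval w.1 +
      2 * w.2 * (derivative (cubicPoly a)).eval w.1 = 0) :
    ¬ IsReduced (IntersectionLocalRing l a p) := by
  have hw := Curve.sq_eq_of_coord_eq_some hp
  obtain ⟨h1, rfl⟩ := Curve.coord_eq_some_iff.mp hp
  change ¬ IsReduced (PlaneLocalRing (chartCoord p.rep) ⧸ intersectionIdeal l a p.rep)
  rw [intersectionIdeal_of_ne_zero a h1]
  refine not_isReduced_of_tangent hw h h' ?_ ?_
  · by_contra! hc
    rw [hc.1, eq_comm, zero_pow two_ne_zero] at hw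
    exact eval_derivative_affineSextic_ne_zero hl hw hc.2
  · have h0 : (affineSextic l).eval 0 = 0 := (eval_affineSextic_eq_zero_iff l 0).mpr ⟨0, rfl⟩
    refine sexticPoly_ne_zero h0 (eval_derivative_affineSextic_ne_zero hl h0) ?_
    exact or_iff_not_imp_left.mpr fun h4 => cubicPoly_ne_zero ha (not_not.mp h4)

/-- If `F` vanishes at `a`, then the intersection of `C` with the cubic is nonreduced. -/
theorem exists_not_isReduced (hl : Function.Injective (branchPoint l))
    (hF : MvPolynomial.X 4 ^ 6 * F = (resultantPoly l).discr) (ha0 : a ≠ 0)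
    (ha : MvPolynomial.eval a F = 0) :
    ∃ p : Curve l, ¬ IsReduced (IntersectionLocalRing l a p) := by
  by_cases h4 : a 4 = 0
  · rcases (eval_eq_zero_iff_of_eq_zero hF h4).mp ha with h0 | ⟨i, hi⟩ | ⟨x, hx, hx'⟩
    · obtain ⟨p, hp⟩ := Curve.exists_coord_eq_none l
      obtain ⟨h1, h2⟩ := Curve.coord_eq_none_iff.mp hp
      refine ⟨p, ?_⟩
      change ¬ IsReduced (PlaneLocalRing (chartCoord p.rep) ⧸ intersectionIdeal l a p.rep)
      rw [intersectionIdeal_of_eq_zero a h1]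
      refine not_isReduced_of_tangent ?_ ?_ ?_ ?_ ?_
      · simp [h2, eval_infinitySextic]
      · simp [h2, eval_cubicPoly, h0]
      · simp [h2, h4]
      · simp [h2, eval_derivative_infinitySextic]
      · refine sexticPoly_ne_zero (eval_infinitySextic l)
          (by simp [eval_derivative_infinitySextic]) (Or.inr (cubicPoly_ne_zero ?_ (by simpa)))
        intro h
        have h3 := congrFun h 0
        have h2 := congrFun h 1
        have h1 := congrFun h 2
        simp at h1 h2 h3
        exact ha0 (funext fun i => by fin_cases i <;> assumption)
    · have hb : (affineSextic l).eval (branchPoint l i) = 0 :=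
        (eval_affineSextic_eq_zero_iff l _).mpr ⟨i, rfl⟩
      obtain ⟨p, hp⟩ := Curve.exists_coord_eq_some (l := l) (w := (branchPoint l i, 0))
        (by simp [hb])
      exact ⟨p, not_isReduced_of_coord_eq_some hl ha0 hp (by simpa using hi) (by simp [h4])⟩
    · obtain ⟨z, hz⟩ := IsAlgClosed.exists_pow_nat_eq ((affineSextic l).eval x) two_pos
      obtain ⟨p, hp⟩ := Curve.exists_coord_eq_some (l := l) (w := (x, z)) hz
      exact ⟨p, not_isReduced_of_coord_eq_some hl ha0 hp (by simpa [h4] using hx)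
        (by simp [h4, hx'])⟩
  · obtain ⟨x, hx, hx'⟩ := (eval_eq_zero_iff_of_ne_zero hF h4).mp ha
    rw [derivative_sexticPoly] at hx'
    simp only [sexticPoly, eval_sub, eval_mul, eval_pow, eval_C, eval_ofNat] at hx hx'
    set z := -(cubicPoly a).eval x / a 4 with hz
    have hcz : (cubicPoly a).eval x = -(a 4 * z) := by rw [hz]; field_simp
    obtain ⟨p, hp⟩ := Curve.exists_coord_eq_some (l := l) (w := (x, z)) (by
      rw [hz]; field_simp; linear_combination -hx)
    refine ⟨p, not_isReduced_of_coord_eq_some hl ha0 hp (by rw [hcz]; ring)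
      (mul_left_cancel₀ h4 ?_)⟩
    rw [hcz] at hx'
    linear_combination hx'

theorem ncard_roots {q : ℂ[X]} (hq : ∀ x, q.eval x = 0 → (derivative q).eval x ≠ 0)
    (hq0 : q ≠ 0) : {x | q.eval x = 0}.ncard = q.natDegree := by
  have hsep : q.Separable := by
    rw [Polynomial.Separable, isCoprime_iff_aeval_ne_zero_of_isAlgClosed (k := ℂ) (K := ℂ)]
    intro x
    by_cases hx : q.eval x = 0
    · right; simpa using hq x hx
    · left; simpa using hx
  have h1 : {x | q.eval x = 0} = (q.roots.toFinset : Set ℂ) := by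
    ext x; simp [hq0]
  rw [h1, Set.ncard_coe_finset, Multiset.toFinset_card_of_nodup (nodup_roots hsep)]
  exact (IsAlgClosed.splits q).natDegree_eq_card_roots.symm

/-- A cubic that is transverse to `C` meets `C` in six points. -/
theorem ncard_intersectionSet (hF : MvPolynomial.X 4 ^ 6 * F = (resultantPoly l).discr)
    (ha : MvPolynomial.eval a F ≠ 0) : (intersectionSet l a).ncard = 6 := by
  by_cases h4 : a 4 = 0
  · rw [Ne, eval_eq_zero_iff_of_eq_zero hF h4] at ha
    push Not at ha
    obtain ⟨h0, hb, hd⟩ := ha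
    have hc0 : cubicPoly a ≠ 0 := fun h => h0 (by rw [← coeff_cubicPoly_three a, h, coeff_zero])
    have hcd : (cubicPoly a).natDegree = 3 := le_antisymm (natDegree_cubicPoly_le a)
      (le_natDegree_of_ne_zero (by rwa [coeff_cubicPoly_three]))
    -- two points over each of the three roots of the cubic
    choose z hz using fun x => IsAlgClosed.exists_pow_nat_eq ((affineSextic l).eval x) two_pos
    have hz0 (x : ℂ) (hx : (cubicPoly a).eval x = 0) : z x ≠ 0 := by
      intro h
      have := hz x
      rw [h, eq_comm, zero_pow two_ne_zero] at this
      obtain ⟨i, hi⟩ := (eval_affineSextic_eq_zero_iff l _).mp this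
      exact hb i (hi ▸ hx)
    have hset : intersectionSet l a = (fun q : ℂ × ℂ => some (q.1, q.2 * z q.1)) ''
        ({x | (cubicPoly a).eval x = 0} ×ˢ {1, -1}) := by
      ext o
      constructor
      · rintro (⟨-, h⟩ | ⟨⟨x, y⟩, rfl, h, hx⟩)
        · exact absurd h h0
        · simp only [h4, zero_mul, add_zero] at hx
          simp only [← hz x] at h
          rcases sq_eq_sq_iff_eq_or_eq_neg.mp h with rfl | rfl
          · exact ⟨(x, 1), ⟨hx, by simp⟩, by simp⟩
          · exact ⟨(x, -1), ⟨hx, by simp⟩, by simp⟩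
      · rintro ⟨⟨x, e⟩, ⟨hx, rfl | he⟩, rfl⟩
        · exact Or.inr ⟨_, rfl, by simpa using hz x, by simpa [h4] using hx⟩
        · rw [Set.mem_singleton_iff] at he
          simp only at he
          subst he
          exact Or.inr ⟨_, rfl, by simpa using hz x, by simpa [h4] using hx⟩
    rw [hset, Set.InjOn.ncard_image, Set.ncard_prod, ncard_roots hd hc0, hcd,
      Set.ncard_pair (by norm_num)]
    rintro ⟨x, e⟩ ⟨hx, -⟩ ⟨x', e'⟩ - h
    simp only [Option.some.injEq, Prod.mk.injEq] at h
    obtain ⟨rfl, h⟩ := h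
    rw [mul_right_cancel₀ (hz0 x hx) h]
  · have hG := (eval_eq_zero_iff_of_ne_zero hF h4).not.mp ha
    push Not at hG
    set G := sexticPoly (affineSextic l) (cubicPoly a) (a 4) with hGdef
    have hG6 : G.coeff 6 = -a 0 ^ 2 := coeff_six_sexticPoly (natDegree_affineSextic l).le a (a 4)
    have hG5 := coeff_five_sexticPoly l (a := a)
    -- the affine points correspond to the roots of `G`, which has degree `5` if `D` passes through
    -- the point at infinity, and degree `6` otherwise
    have haff : ((fun x => some (x, -(cubicPoly a).eval x / a 4)) '' {x | G.eval x = 0}).ncard =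
        G.natDegree := by
      rw [Set.ncard_image_of_injective _ fun x y h => by
        simpa using congrArg (Option.map Prod.fst) h, ncard_roots hG]
      intro hG0
      by_cases h0 : a 0 = 0
      · rw [← hGdef, hG0, coeff_zero] at hG5
        exact h4 (by simpa using (hG5 h0).symm)
      · rw [hG0, coeff_zero] at hG6
        exact h0 (by simpa using hG6.symm)
    have hset : intersectionSet l a \ {none} =
        (fun x => some (x, -(cubicPoly a).eval x / a 4)) '' {x | G.eval x = 0} := by
      ext o
      constructor
      · rintro ⟨⟨h, -⟩ | ⟨⟨x, y⟩, rfl, h, hx⟩, ho⟩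
        · exact absurd h ho
        · simp only at h hx
          refine ⟨x, ?_, ?_⟩
          · rw [Set.mem_ofPred_eq, hGdef, sexticPoly]
            simp only [eval_sub, eval_mul, eval_pow, eval_C, ← h, eq_neg_of_add_eq_zero_left hx]
            ring
          · simp only [Option.some.injEq, Prod.mk.injEq, true_and]
            rw [eq_neg_of_add_eq_zero_left hx]
            field_simp
      · rintro ⟨x, hx, rfl⟩
        rw [Set.mem_ofPred_eq, hGdef, sexticPoly] at hx
        simp only [eval_sub, eval_mul, eval_pow, eval_C] at hx
        refine ⟨Or.inr ⟨_, rfl, ?_, ?_⟩, by simp⟩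
        · field_simp
          linear_combination -hx
        · field_simp
          ring
    by_cases h0 : a 0 = 0
    · have hdeg : G.natDegree = 5 := by
        refine le_antisymm ?_ (le_natDegree_of_ne_zero (by rw [hG5 h0]; exact pow_ne_zero 2 h4))
        have h2 := natDegree_cubicPoly_le_two h0
        rw [hGdef, sexticPoly, ← C_pow]
        exact (natDegree_sub_le _ _).trans (max_le ((natDegree_C_mul_le _ _).trans
          (natDegree_affineSextic l).le) (natDegree_pow_le.trans (by omega)))
      have hmem : none ∈ intersectionSet l a := Or.inl ⟨rfl, h0⟩
      have hfin : (intersectionSet l a \ {none}).Finite :=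
        Set.finite_of_ncard_ne_zero (by rw [hset, haff, hdeg]; norm_num)
      rw [← Set.insert_sdiff_self_of_mem hmem, Set.ncard_insert_of_notMem (by simp) hfin, hset,
        haff, hdeg]
    · have hmem : none ∉ intersectionSet l a := by
        rintro (⟨-, h⟩ | ⟨w, h, -⟩)
        · exact h0 h
        · simp at h
      rw [← Set.sdiff_singleton_eq_self hmem, hset, haff]
      exact le_antisymm (natDegree_sexticPoly_le (natDegree_affineSextic l).le
        (natDegree_cubicPoly_le a)) (le_natDegree_of_ne_zero (by rw [hG6]; simpa using h0))

end Points

/-! ### Decompositions of six points into three pairs -/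

section Pairings

variable {X Y : Type}

/-- The decomposition `{w₀, w₁}, {w₂, w₃}, {w₄, w₅}` of the six points `w₀, …, w₅` into pairs. -/
def pairing (w : Fin 6 → X) : Sym (Sym X 2) 3 :=
  ⟨{⟨{w 0, w 1}, rfl⟩, ⟨{w 2, w 3}, rfl⟩, ⟨{w 4, w 5}, rfl⟩}, rfl⟩

theorem exists_pairing_eq (σ : Sym (Sym X 2) 3) : ∃ w, pairing w = σ := by
  obtain ⟨s, hs⟩ := σ
  obtain ⟨⟨p, hp⟩, ⟨q, hq⟩, ⟨r, hr⟩, rfl⟩ := Multiset.card_eq_three.mp hs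
  obtain ⟨a, b, rfl⟩ := Multiset.card_eq_two.mp hp
  obtain ⟨c, d, rfl⟩ := Multiset.card_eq_two.mp hq
  obtain ⟨e, f, rfl⟩ := Multiset.card_eq_two.mp hr
  exact ⟨![a, b, c, d, e, f], rfl⟩

theorem sumMap_pairing (w : Fin 6 → X) : sumMap (pairing w) = Finset.univ.val.map w := by
  change ({w 0, w 1} + ({w 2, w 3} + ({w 4, w 5} + 0)) : Multiset X) = _
  rfl

theorem map_map_pairing (e : Y → X) (w : Fin 6 → Y) :
    Sym.map (Sym.map e) (pairing w) = pairing (e ∘ w) := rfl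

theorem pairing_swap_fst (a b c d e f : X) :
    pairing ![b, a, c, d, e, f] = pairing ![a, b, c, d, e, f] := by
  refine Subtype.ext ?_
  simp [pairing, Multiset.pair_comm b a]

theorem pairing_swap_snd (a b c d e f : X) :
    pairing ![a, b, d, c, e, f] = pairing ![a, b, c, d, e, f] := by
  refine Subtype.ext ?_
  simp [pairing, Multiset.pair_comm d c]

theorem pairing_swap_trd (a b c d e f : X) :
    pairing ![a, b, c, d, f, e] = pairing ![a, b, c, d, e, f] := by
  refine Subtype.ext ?_
  simp [pairing, Multiset.pair_comm f e]

theorem pairing_swap_fst_snd (a b c d e f : X) :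
    pairing ![c, d, a, b, e, f] = pairing ![a, b, c, d, e, f] :=
  Subtype.ext (Multiset.cons_swap (⟨{c, d}, rfl⟩ : Sym X 2) ⟨{a, b}, rfl⟩
    {(⟨{e, f}, rfl⟩ : Sym X 2)})

theorem pairing_swap_snd_trd (a b c d e f : X) :
    pairing ![a, b, e, f, c, d] = pairing ![a, b, c, d, e, f] :=
  Subtype.ext (congrArg (Multiset.cons (⟨{a, b}, rfl⟩ : Sym X 2))
    (Multiset.cons_swap (⟨{e, f}, rfl⟩ : Sym X 2) ⟨{c, d}, rfl⟩ 0))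

/-- Representatives of the fifteen decompositions of `Fin 6` into three pairs. -/
def pairingList : List (Fin 6 → Fin 6) :=
  [![0, 1, 2, 3, 4, 5], ![0, 1, 2, 4, 3, 5], ![0, 1, 2, 5, 3, 4],
   ![0, 2, 1, 3, 4, 5], ![0, 2, 1, 4, 3, 5], ![0, 2, 1, 5, 3, 4],
   ![0, 3, 1, 2, 4, 5], ![0, 3, 1, 4, 2, 5], ![0, 3, 1, 5, 2, 4],
   ![0, 4, 1, 2, 3, 5], ![0, 4, 1, 3, 2, 5], ![0, 4, 1, 5, 2, 3],
   ![0, 5, 1, 2, 3, 4], ![0, 5, 1, 3, 2, 4], ![0, 5, 1, 4, 2, 3]]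

/-- A number that determines a decomposition of `Fin 6` into pairs: the sum of `2 ^ (2 ^ i + 2 ^ j)`
over the pairs `{i, j}`. -/
def pairingCode (σ : Sym (Sym (Fin 6) 2) 3) : ℕ :=
  ((σ : Multiset (Sym (Fin 6) 2)).map fun η =>
    2 ^ ((η : Multiset (Fin 6)).map fun i => 2 ^ (i : ℕ)).sum).sum

theorem nodup_map_pairingList : (pairingList.map pairing).Nodup := by
  refine List.Nodup.of_map pairingCode ?_
  have : (pairingList.map pairing).map pairingCode = pairingList.map fun w =>
      2 ^ (2 ^ (w 0 : ℕ) + (2 ^ (w 1 : ℕ) + 0)) + (2 ^ (2 ^ (w 2 : ℕ) + (2 ^ (w 3 : ℕ) + 0)) +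
        (2 ^ (2 ^ (w 4 : ℕ) + (2 ^ (w 5 : ℕ) + 0)) + 0)) := by
    rw [List.map_map]
    rfl
  rw [this]
  decide

theorem mem_pairingList_of_sorted : ∀ c d : Fin 6, c < d → ∀ e, c < e → ∀ f, e < f →
    ∀ b, [0, b, c, d, e, f].Nodup → ![0, b, c, d, e, f] ∈ pairingList := by
  decide

theorem pairing_mem_of_zero (b c d e f : Fin 6) (h : [0, b, c, d, e, f].Nodup) :
    pairing ![0, b, c, d, e, f] ∈ pairingList.map pairing := by
  have key : ∀ c d e f : Fin 6, [0, b, c, d, e, f].Nodup → c < d → e < f →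
      pairing ![0, b, c, d, e, f] ∈ pairingList.map pairing := by
    intro c d e f h hcd hef
    rcases lt_trichotomy c e with hce | rfl | hce
    · exact List.mem_map_of_mem (mem_pairingList_of_sorted c d hcd e hce f hef b h)
    · simp at h
    · rw [← pairing_swap_snd_trd]
      exact List.mem_map_of_mem (mem_pairingList_of_sorted e f hef c hce d hcd b
        ((((List.perm_append_comm (l₁ := [c, d]) (l₂ := [e, f])).cons b).cons 0).nodup_iff.mp h))
  have key' : ∀ c d e f : Fin 6, [0, b, c, d, e, f].Nodup → c < d →
      pairing ![0, b, c, d, e, f] ∈ pairingList.map pairing := by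
    intro c d e f h hcd
    rcases lt_trichotomy e f with hef | rfl | hef
    · exact key c d e f h hcd hef
    · simp at h
    · rw [← pairing_swap_trd]
      exact key c d f e
        (((((List.Perm.swap f e []).cons d).cons c).cons b |>.cons 0).nodup_iff.mp h) hcd hef
  rcases lt_trichotomy c d with hcd | rfl | hcd
  · exact key' c d e f h hcd
  · simp at h
  · rw [← pairing_swap_snd]
    exact key' d c e f ((((List.Perm.swap d c [e, f]).cons b).cons 0).nodup_iff.mp h) hcd

theorem pairing_mem_of_nodup (a b c d e f : Fin 6) (h : [a, b, c, d, e, f].Nodup) :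
    pairing ![a, b, c, d, e, f] ∈ pairingList.map pairing := by
  have h0 : (a = 0 ∨ b = 0) ∨ (c = 0 ∨ d = 0) ∨ (e = 0 ∨ f = 0) := by
    have : (0 : Fin 6) ∈ [a, b, c, d, e, f].toFinset := by
      rw [Finset.eq_univ_of_card [a, b, c, d, e, f].toFinset
        (by rw [List.toFinset_card_of_nodup h]; rfl)]
      exact Finset.mem_univ 0
    simpa [eq_comm, or_assoc] using this
  have key : ∀ a b c d e f : Fin 6, [a, b, c, d, e, f].Nodup → a = 0 ∨ b = 0 →
      pairing ![a, b, c, d, e, f] ∈ pairingList.map pairing := by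
    rintro a b c d e f h (rfl | rfl)
    · exact pairing_mem_of_zero b c d e f h
    · rw [← pairing_swap_fst]
      exact pairing_mem_of_zero a c d e f ((List.Perm.swap _ _ _).nodup_iff.mp h)
  rcases h0 with h0 | h0 | h0
  · exact key a b c d e f h h0
  · rw [← pairing_swap_fst_snd]
    refine key c d a b e f (List.Perm.nodup_iff ?_ |>.mp h) h0
    exact (List.perm_append_comm (l₁ := [a, b]) (l₂ := [c, d])).append_right [e, f]
  · rw [← pairing_swap_snd_trd, ← pairing_swap_fst_snd]
    refine key e f a b c d (List.Perm.nodup_iff ?_ |>.mp h) h0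
    exact List.perm_append_comm (l₁ := [a, b, c, d]) (l₂ := [e, f])

/-- The decompositions of `Fin 6` into pairs are those in `pairingList`. -/
theorem range_pairing_perm :
    Set.range (fun τ : Equiv.Perm (Fin 6) => pairing τ) =
      ((pairingList.map pairing).toFinset : Set (Sym (Sym (Fin 6) 2) 3)) := by
  ext σ
  rw [List.coe_toFinset, Set.mem_ofPred_eq]
  constructor
  · rintro ⟨τ, rfl⟩
    have h : (List.ofFn τ).Nodup := List.nodup_ofFn.mpr τ.injective
    have h' := pairing_mem_of_nodup _ _ _ _ _ _ h
    exact h'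
  · rw [List.mem_map]
    rintro ⟨w, hw, rfl⟩
    have hw' : Function.Bijective w := by
      have : ∀ w ∈ pairingList, (List.ofFn w).Nodup := by simp [pairingList]
      exact Finite.injective_iff_bijective.mp (List.nodup_ofFn.mp (this w hw))
    exact ⟨Equiv.ofBijective w hw', rfl⟩

theorem ncard_range_pairing_perm :
    (Set.range (fun τ : Equiv.Perm (Fin 6) => pairing τ)).ncard = 15 := by
  rw [range_pairing_perm, Set.ncard_coe_finset, List.toFinset_card_of_nodup nodup_map_pairingList]
  rfl

/-- Two labellings of the same multiset differ by a permutation of the labels. -/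
theorem exists_perm_of_map_univ_eq {n : ℕ} {w e : Fin n → X}
    (h : Finset.univ.val.map w = Finset.univ.val.map e) :
    ∃ τ : Equiv.Perm (Fin n), w = e ∘ τ := by
  classical
  have hfib (x : X) : Nonempty ({i // w i = x} ≃ {i // e i = x}) := by
    rw [← Fintype.card_eq, Fintype.card_subtype, Fintype.card_subtype]
    have := congrArg (Multiset.count x) h
    rw [Multiset.count_map, Multiset.count_map] at this
    simpa [Finset.card, Finset.filter_val, eq_comm] using this
  exact ⟨Equiv.ofFiberEquiv fun x => (hfib x).some, funext fun i =>
    (Equiv.ofFiberEquiv_map _ i).symm⟩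

/-- The decompositions of the divisor `e₀ + ⋯ + e₅` are the images of those of its labels. -/
theorem setOf_sumMap_eq (e : Fin 6 → X) :
    {σ : Sym (Sym X 2) 3 | sumMap σ = Finset.univ.val.map e} =
      Sym.map (Sym.map e) '' Set.range (fun τ : Equiv.Perm (Fin 6) => pairing τ) := by
  ext σ
  constructor
  · intro h
    obtain ⟨w, rfl⟩ := exists_pairing_eq σ
    rw [Set.mem_ofPred_eq, sumMap_pairing] at h
    obtain ⟨τ, rfl⟩ := exists_perm_of_map_univ_eq h
    exact ⟨_, ⟨τ, rfl⟩, rfl⟩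
  · rintro ⟨_, ⟨τ, rfl⟩, rfl⟩
    rw [map_map_pairing, Set.mem_ofPred_eq, sumMap_pairing, ← Multiset.map_map,
      Multiset.map_univ_val_equiv]

/-- Six distinct points can be decomposed into pairs in fifteen ways. -/
theorem ncard_sumMap_eq_of_nodup {m : Multiset X} (hm : m.card = 6) (hnd : m.Nodup) :
    {σ : Sym (Sym X 2) 3 | sumMap σ = m}.ncard = 15 := by
  obtain ⟨L, rfl⟩ := Quot.exists_rep m
  change L.length = 6 at hm
  obtain ⟨e, rfl⟩ : ∃ e : Fin 6 → X, List.ofFn e = L := by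
    rw [← hm]
    exact ⟨L.get, List.ofFn_get L⟩
  have he : Function.Injective e := List.nodup_ofFn.mp hnd
  have : (Quot.mk _ (List.ofFn e) : Multiset X) = Finset.univ.val.map e :=
    (Fin.univ_val_map e).symm
  rw [this, setOf_sumMap_eq, Set.ncard_image_of_injective, ncard_range_pairing_perm]
  exact Sym.map_injective (Sym.map_injective he 2) 3

/-- Points that are not distinct do not have exactly fifteen decompositions into three pairs: those
of six labels map onto them, but not injectively. -/
theorem ncard_sumMap_eq_ne_of_not_nodup {m : Multiset X} (hnd : ¬ m.Nodup) :
    {σ : Sym (Sym X 2) 3 | sumMap σ = m}.ncard ≠ 15 := by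
  rcases Set.eq_empty_or_nonempty {σ : Sym (Sym X 2) 3 | sumMap σ = m} with h | ⟨σ, hσ⟩
  · rw [h]; simp
  obtain ⟨w, rfl⟩ := exists_pairing_eq σ
  rw [Set.mem_ofPred_eq, sumMap_pairing] at hσ
  obtain ⟨p, r, rfl⟩ : ∃ p r, m = p ::ₘ p ::ₘ r := by
    simpa [Multiset.nodup_iff_ne_cons_cons] using hnd
  have hr : r.card = 4 := by
    have := congrArg Multiset.card hσ
    simp at this
    omega
  obtain ⟨a, b, c, d, rfl⟩ : ∃ a b c d, r = {a, b, c, d} := by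
    obtain ⟨a, t, rfl, ht⟩ := Multiset.card_eq_succ_iff.mp hr
    obtain ⟨b, c, d, rfl⟩ := Multiset.card_eq_three.mp ht
    exact ⟨a, b, c, d, rfl⟩
  set e : Fin 6 → X := ![p, p, a, b, c, d]
  have hm : (p ::ₘ p ::ₘ {a, b, c, d} : Multiset X) = Finset.univ.val.map e := rfl
  rw [hm, setOf_sumMap_eq, ← ncard_range_pairing_perm]
  intro h
  have hinj := (Set.ncard_image_iff (Set.finite_range _)).mp h
  -- two decompositions of the labels that differ by the exchange of `0` and `1`, both of which
  -- are labels of the repeated point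
  let τ₁ : Equiv.Perm (Fin 6) := Equiv.swap 1 2
  let τ₂ : Equiv.Perm (Fin 6) := Equiv.swap 0 1 * Equiv.swap 1 2
  have h1 := hinj ⟨τ₁, rfl⟩ ⟨τ₂, rfl⟩ (by
    rw [map_map_pairing, map_map_pairing]
    congr 1
    funext i
    fin_cases i <;> rfl)
  have h2 := congrArg pairingCode h1
  revert h2
  decide

end Pairings

/-! ### The fibres of the covering -/

variable {l : Fin 3 → ℂ} {F : MvPolynomial (Fin 5) ℂ}

/-- The fibre of the covering over `D` is the set of decompositions of `D ∩ C`. -/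
theorem card_fibre_covering (l : Fin 3 → ℂ) (D : LinearSystem) :
    Nat.card (covering l ⁻¹' {D}) =
      {σ : Sym (Sym (Curve l) 2) 3 | IsIntersectionDivisor l D (sumMap σ)}.ncard := by
  rw [← Nat.card_coe_set_eq]
  refine Nat.card_congr
    { toFun := fun q => ⟨q.1.1.1, ?_⟩
      invFun := fun σ => ⟨⟨(σ.1, D), σ.2⟩, rfl⟩
      left_inv := ?_
      right_inv := fun σ => rfl }
  · obtain ⟨⟨⟨σ, D'⟩, h⟩, rfl⟩ := q
    exact h
  · rintro ⟨⟨⟨σ, D'⟩, h⟩, rfl⟩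
    rfl

/-- A divisor is determined by its multiplicities. -/
theorem IsIntersectionDivisor.unique {D : LinearSystem} {m m' : Multiset (Curve l)}
    (h : IsIntersectionDivisor l D m) (h' : IsIntersectionDivisor l D m') : m = m' := by
  classical
  refine Multiset.ext' fun p => ?_
  have := (h p).trans (h' p).symm
  convert Nat.cast_injective (R := ℕ∞) this

theorem setOf_isIntersectionDivisor_eq {D : LinearSystem} {m : Multiset (Curve l)}
    (h : IsIntersectionDivisor l D m) :
    {σ : Sym (Sym (Curve l) 2) 3 | IsIntersectionDivisor l D (sumMap σ)} = {σ | sumMap σ = m} := by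
  ext σ
  exact ⟨fun hσ => hσ.unique h, fun hσ => by
    rw [Set.mem_ofPred_eq] at hσ ⊢
    rwa [hσ]⟩

/-- If `F` does not vanish at `D`, the intersection `D ∩ C` consists of six simple points. -/
theorem exists_isIntersectionDivisor (hF : MvPolynomial.X 4 ^ 6 * F = (resultantPoly l).discr)
    {D : LinearSystem} (ha : MvPolynomial.eval D.rep F ≠ 0) :
    (∃ m : Multiset (Curve l), m.card = 6 ∧ m.Nodup ∧ IsIntersectionDivisor l D m) ∧
      ∀ p, IsReduced (IntersectionLocalRing l D.rep p) := by
  classical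
  set S : Set (Curve l) := Curve.coord ⁻¹' intersectionSet l D.rep with hS
  have hcard : S.ncard = 6 := by
    rw [hS, Set.ncard_preimage_of_injective_subset_range Curve.coord_injective
      (intersectionSet_subset_range l D.rep), ncard_intersectionSet hF ha]
  have hfin : S.Finite := Set.finite_of_ncard_ne_zero (by rw [hcard]; norm_num)
  have hin (p : Curve l) (hp : p ∈ S) : IsReduced (IntersectionLocalRing l D.rep p) ∧
      intersectionMultiplicity l D.rep p = 1 :=
    isReduced_and_length_quotient_maximalIdeal (isMaximal_intersectionIdeal hF ha hp)
  have hout (p : Curve l) (hp : p ∉ S) : Subsingleton (IntersectionLocalRing l D.rep p) := by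
    change Subsingleton (PlaneLocalRing (chartCoord p.rep) ⧸ intersectionIdeal l D.rep p.rep)
    rw [intersectionIdeal_eq_top hp]
    infer_instance
  refine ⟨⟨hfin.toFinset.val, ?_, hfin.toFinset.nodup, fun p => ?_⟩, fun p => ?_⟩
  · rw [Finset.card_val, ← Set.ncard_eq_toFinset_card S hfin, hcard]
  · by_cases hp : p ∈ S
    · rw [(hin p hp).2, Multiset.count_eq_one_of_mem hfin.toFinset.nodup (hfin.mem_toFinset.mpr hp),
        Nat.cast_one]
    · have := hout p hp
      rw [Multiset.count_eq_zero_of_notMem (fun h => hp (hfin.mem_toFinset.mp h)),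
        intersectionMultiplicity, Module.length_eq_zero, Nat.cast_zero]
  · by_cases hp : p ∈ S
    · exact (hin p hp).1
    · have := hout p hp
      infer_instance

/-- If `D ∩ C` is nonreduced, then a divisor supported on it has a repeated point. -/
theorem IsIntersectionDivisor.not_nodup {D : LinearSystem} {m : Multiset (Curve l)}
    (h : IsIntersectionDivisor l D m) {p : Curve l}
    (hp : ¬ IsReduced (IntersectionLocalRing l D.rep p)) : ¬ m.Nodup := by
  classical
  intro hnd
  refine hp (isReduced_of_length_le_one ?_)
  have h1 := Multiset.nodup_iff_count_le_one.mp hnd p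
  have h2 := h p
  change _ = Module.length _ _ at h2
  rw [← h2]
  exact_mod_cast (by convert h1)

/-- The branch locus, the locus of nonreduced intersections and the zero locus of `F` agree. -/
theorem mem_cubicBranchLocus_iff (hl : Function.Injective (branchPoint l))
    (hF : MvPolynomial.X 4 ^ 6 * F = (resultantPoly l).discr) (D : LinearSystem) :
    (D ∈ cubicBranchLocus l ↔ ∃ p, ¬ IsReduced (IntersectionLocalRing l D.rep p)) ∧
      (D ∈ cubicBranchLocus l ↔ MvPolynomial.eval D.rep F = 0) := by
  have hB : D ∈ cubicBranchLocus l ↔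
      {σ : Sym (Sym (Curve l) 2) 3 | IsIntersectionDivisor l D (sumMap σ)}.ncard ≠ 15 := by
    rw [← card_fibre_covering]
    rfl
  rw [hB]
  by_cases ha : MvPolynomial.eval D.rep F = 0
  · obtain ⟨p, hp⟩ := exists_not_isReduced hl hF D.rep_nonzero ha
    have : {σ : Sym (Sym (Curve l) 2) 3 | IsIntersectionDivisor l D (sumMap σ)}.ncard ≠ 15 := by
      rcases Set.eq_empty_or_nonempty
        {σ : Sym (Sym (Curve l) 2) 3 | IsIntersectionDivisor l D (sumMap σ)} with h | ⟨σ, hσ⟩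
      · simp [h]
      · rw [setOf_isIntersectionDivisor_eq hσ]
        exact ncard_sumMap_eq_ne_of_not_nodup (hσ.not_nodup hp)
    exact ⟨iff_of_true this ⟨p, hp⟩, iff_of_true this ha⟩
  · obtain ⟨⟨m, hm, hnd, hmD⟩, hred⟩ := exists_isIntersectionDivisor hF ha
    have := ncard_sumMap_eq_of_nodup hm hnd
    rw [← setOf_isIntersectionDivisor_eq hmD] at this
    exact ⟨iff_of_false (not_not_intro this) fun ⟨p, hp⟩ => hp (hred p),
      iff_of_false (not_not_intro this) ha⟩

theorem eval_mul_of_isHomogeneous {ι R : Type*} [CommSemiring R] [Fintype ι]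
    {P : MvPolynomial ι R} {n : ℕ} (hP : P.IsHomogeneous n) (t : R) (a : ι → R) :
    MvPolynomial.eval (fun i => t * a i) P = t ^ n * MvPolynomial.eval a P := by
  rw [MvPolynomial.eval_eq', MvPolynomial.eval_eq', Finset.mul_sum]
  refine Finset.sum_congr rfl fun d hd => ?_
  have h : ∑ i, d i = n := by
    rw [← hP (MvPolynomial.mem_support_iff.mp hd), Finsupp.weight_apply, Finsupp.sum_fintype]
      <;> simp
  simp_rw [mul_pow]
  rw [Finset.prod_mul_distrib, Finset.prod_pow_eq_pow_sum, h]
  ring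

theorem mk_mem_cubicBranchLocus_iff (hl : Function.Injective (branchPoint l))
    (hF : MvPolynomial.X 4 ^ 6 * F = (resultantPoly l).discr) (a : Fin 5 → ℂ) (ha : a ≠ 0) :
    Projectivization.mk ℂ a ha ∈ cubicBranchLocus l ↔ MvPolynomial.eval a F = 0 := by
  rw [(mem_cubicBranchLocus_iff hl hF _).2]
  obtain ⟨t, ht⟩ := Projectivization.exists_smul_eq_mk_rep ℂ a ha
  rw [← ht, show t • a = fun i => (t : ℂ) * a i from rfl,
    eval_mul_of_isHomogeneous (isHomogeneous_of_mul_eq_discr hF)]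
  simp

end GenusTwoCubics

end

theorem mainTheorem11 (l : Fin 3 → ℂ) (hl : Function.Injective l)
    (hl0 : ∀ i, l i ≠ 0) (hl1 : ∀ i, l i ≠ 1) :
    GenusTwoCubics.cubicBranchLocus l =
      {D | ∃ p : GenusTwoCubics.Curve l,
        ¬ IsReduced (GenusTwoCubics.IntersectionLocalRing l D.rep p)} ∧
    ∃ F : MvPolynomial (Fin 5) ℂ,
      MvPolynomial.X 4 ^ 6 * F = (GenusTwoCubics.resultantPoly l).discr ∧
      F.IsHomogeneous 14 ∧
      (∀ (a : Fin 5 → ℂ) (ha : a ≠ 0),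
        Projectivization.mk ℂ a ha ∈ GenusTwoCubics.cubicBranchLocus l ↔
          MvPolynomial.eval a F = 0) ∧
      MvPolynomial.vanishingIdeal ℂ
        (GenusTwoCubics.affineCone (GenusTwoCubics.cubicBranchLocus l)) = Ideal.span {F} := by
  have hb := GenusTwoCubics.branchPoint_injective hl hl0 hl1
  obtain ⟨F, hF⟩ := GenusTwoCubics.exists_mul_eq_discr_resultantPoly l
  have hmk := GenusTwoCubics.mk_mem_cubicBranchLocus_iff hb hF
  refine ⟨Set.ext fun D => (GenusTwoCubics.mem_cubicBranchLocus_iff hb hF D).1, F, hF,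
    GenusTwoCubics.isHomogeneous_of_mul_eq_discr hF, hmk,
    GenusTwoCubics.vanishingIdeal_eq_span hb hF (fun a ha => ?_) fun ⟨h, _⟩ => h rfl⟩
  exact ⟨fun ⟨_, h⟩ => (hmk a ha).mp h, fun h => ⟨ha, (hmk a ha).mpr h⟩⟩
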